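/- Conventions. A quandle is a set $X$ with an operation $*$ such that $x*x=x$, each map $\bullet\mapsto\bullet*x$ is bijective, and $(x*y)*z=(x*z)*(y*z)$. Its associated group is $\mathrm{As}(X)=\langle x\in X\mid x*y=y^{-1}xy\rangle$, and an $X$-set is a set $Y$ with a right action of $\mathrm{As}(X)$; examples are $X$ itself with $y\cdot x=y*x$, and a singleton $\{y_0\}$. For an $X$-set $Y$ let $C_n^Q(X)_Y$ be the free abelian group on $Y\times X^n$ modulo the tuples $(y;x_1,\dots,x_n)$ with $x_i=x_{i+1}$ for some $i$, with boundary $\partial_n=\partial_n^0-\partial_n^1$, where $$\partial_n^0(y;x_1,\dots,x_n)=\sum_{i=1}^n(-1)^i(y;x_1,\dots,x_{i-1},x_{i+1},\dots,x_n),$$ $$\partial_n^1(y;x_1,\dots,x_n)=\sum_{i=1}^n(-1)^i(y\cdot x_i;x_1*x_i,\dots,x_{i-1}*x_i,x_{i+1},\dots,x_n).$$ For an abelian group $A$, an $n$-cocycle over $Y$ is a homomorphism $\lambda:C_n^Q(X)_Y\to A$ with $\lambda\circ\partial_{n+1}=0$; for $Y=\{y_0\}$ it is called a quandle $n$-cocycle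 and $y_0$ is dropped from the notation. Thus a quandle $2$-cocycle is a map $\phi:X^2\to A$ with $\phi(x,x)=0$ and $\phi(x,z)-\phi(x,y)-\phi(x*y,z)+\phi(x*z,y*z)=0$. Let $D$ be a diagram of an oriented classical (tame) link $L\subset\mathbb R^3$, that is, the projection to $\mathbb R^2$, with over/under information, of an oriented polygonal link in regular position that is ambient isotopic to $L$. Each arc has the normal vector obtained from its direction by a counterclockwise right-angle rotation. The fundamental quandle $Q_D$ is generated by the arcs of $D$, with a relation $a*b=c$ at each crossing, where $b$ is the over arc and its normal vector points from the under arc $a$ to the under arc $c$. There is a unique map from the regions of $D$ (the components of the complement of $D$ in $\mathbb R^2$) to $\mathrm{As}(Q_D)$ that sends the unbounded region to the identity and satisfies $r_1\cdot a=r_2$ whenever the normal vector of an arc $a$ points from the region $r_1$ to the region $r_2$ (we write a region for its image). The fundamental class $[D]\in H_2^Q(Q_D)_{\mathrm{As}(Q_D)}$ is represented by the sum over all crossings $\tau$ of $\varepsilon(\tau)\,(r;x,y)$, where $\varepsilon(\tau)$ is the sign of $\tau$, $r$ is the region at $\tau$ from which the normal vectors of both strands point, $x$ is the under arc facing $r$,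 and $y$ is the over arc. Let $X$ be a finite quandle. For a $2$-cocycle $\lambda$ over an $X$-set $Y$ and $y\in Y$, put $$\Psi_\lambda^y(D)=\sum_{c}\big\langle s^y_*c_*[D],[\lambda]\big\rangle\in\mathbb Z[A],$$ where $c$ runs over all quandle homomorphisms $Q_D\to X$, $c_*$ is induced by $(g;x_1,x_2)\mapsto(\mathrm{As}(c)(g);c(x_1),c(x_2))$, $s^y_*$ is induced by $(g;x_1,x_2)\mapsto(y\cdot g;x_1,x_2)$, and each element of $A$ given by the pairing is regarded as a basis element of $\mathbb Z[A]$. The quandle cocycle invariant of a quandle $2$-cocycle $\phi$ is $\Phi_\phi(L)=\Psi_\phi^{y_0}(D)$. The shadow cocycle invariant of a quandle $3$-cocycle $\theta$ and $x\in X$ is $\Phi^x_\theta(L)=\Psi^x_{\iota^\sharp\theta}(D)$, where $\iota^\sharp\theta(x_0;x_1,x_2)=\theta(x_0,x_1,x_2)$ is a $2$-cocycle over the $X$-set $X$. Both are computed from an arbitrary diagram $D$ of $L$. Theorem. Let $L$ be an oriented classical link, $X$ a finite quandle, $A$ an abelian group and $\phi$ a quandle $2$-cocycle of $X$ with values in $A$.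 Let $\sigma^\sharp\phi=\phi\circ\sigma_3$ with $\sigma_n=(-1)^n\partial_n^0$, so that $$\sigma^\sharp\phi(x,y,z)=\phi(y,z)-\phi(x,z)+\phi(x,y).$$ Then for every $x\in X$, with both sides computed from the same diagram of $L$, for every such diagram, $$\Phi^x_{\sigma^\sharp\phi}(L)=\Phi_\phi(L)\in\mathbb Z[A].$$ -/

import Mathlib

open Filter Topology
open scoped Quandles

noncomputable section

namespace ShiftQuandle

universe u v w

/-! ### Quandles, associated groups and `X`-sets

Mathlib writes the quandle operation as a left action: the right operation `x * y` is `y ◃ x`. -/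

/-- The right quandle operation `x * y`. -/
def qop {X : Type u} [Quandle X] (x y : X) : X := y ◃ x

/-- The relators `(y⁻¹ x y)⁻¹ (x * y)` of the associated group. -/
def asRels (X : Type u) [Quandle X] : Set (FreeGroup X) :=
  {r | ∃ x y : X, r =
    ((FreeGroup.of y)⁻¹ * FreeGroup.of x * FreeGroup.of y)⁻¹ * FreeGroup.of (qop x y)}

/-- The associated group `As(X) = ⟨x ∈ X | x * y = y⁻¹ x y⟩`. -/
def As (X : Type u) [Quandle X] : Type u := PresentedGroup (asRels X)

instance (X : Type u) [Quandle X] : Group (As X) :=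
  inferInstanceAs (Group (PresentedGroup (asRels X)))

/-- An element of `X` regarded as an element of `As(X)`. -/
def As.of {X : Type u} [Quandle X] (x : X) : As X := PresentedGroup.of x

theorem As.of_qop {X : Type u} [Quandle X] (x y : X) :
    As.of (qop x y) = (As.of y)⁻¹ * As.of x * As.of y := by
  have h : (PresentedGroup.mk (asRels X)) (((FreeGroup.of y)⁻¹ * FreeGroup.of x *
      FreeGroup.of y)⁻¹ * FreeGroup.of (qop x y)) = 1 :=
    PresentedGroup.one_of_mem ⟨x, y, rfl⟩
  rw [map_mul, map_inv, inv_mul_eq_one] at h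
  exact h.symm

/-- The universal property of `As(X)`. -/
def As.lift {X : Type u} [Quandle X] {G : Type w} [Group G] (f : X → G)
    (hf : ∀ x y, f (qop x y) = (f y)⁻¹ * f x * f y) : As X →* G :=
  PresentedGroup.toGroup (f := f) (by
    rintro r ⟨x, y, rfl⟩
    simp [hf, mul_assoc])

/-- The group homomorphism `As(f) : As(Q) → As(X)` induced by a quandle homomorphism. -/
def As.map {Q : Type u} {X : Type v} [Quandle Q] [Quandle X] (f : Q →◃ X) : As Q →* As X :=
  As.lift (fun q => As.of (f q)) (fun x y => by
    rw [← As.of_qop]; exact congrArg As.of f.map_act')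

/-- The homomorphism to the (opposite) permutation group by which `As(X)` acts on `X`. -/
def As.toPermOp (X : Type u) [Quandle X] : As X →* (Equiv.Perm X)ᵐᵒᵖ :=
  As.lift (fun x => MulOpposite.op (Rack.act' x)) (fun x y => by
    apply MulOpposite.unop_injective
    simp [qop, Rack.ad_conj, mul_assoc])

/-- A right action of `As(X)` on `Y` (an `X`-set) is an action of the opposite group of `As(X)`;
`y · g` is `MulOpposite.op g • y`. -/
abbrev XSet (X : Type u) [Quandle X] (Y : Type v) := MulAction (As X)ᵐᵒᵖ Y

/-- The `X`-set `X`, where `y · x = y * x`. -/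
instance selfXSet (X : Type u) [Quandle X] : XSet X X where
  smul g y := (As.toPermOp X g.unop).unop y
  one_smul y := by
    change (As.toPermOp X (1 : (As X)ᵐᵒᵖ).unop).unop y = y
    simp
  mul_smul g h y := by
    change (As.toPermOp X (g * h).unop).unop y =
      (As.toPermOp X g.unop).unop ((As.toPermOp X h.unop).unop y)
    simp

/-- The orbit map `s^y : As(X) → Y`, `g ↦ y · g`. -/
def orbitMap (X : Type u) [Quandle X] {Y : Type v} [XSet X Y] (y : Y) (g : As X) : Y :=
  MulOpposite.op g • y

/-! ### Generalized quandle homology -/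

/-- `C_n^R(X)_Y`, the free abelian group on `Y × X^n`. -/
abbrev RackChain (X : Type u) (Y : Type v) (n : ℕ) := FreeAbelianGroup (Y × (Fin n → X))

/-- `C_n^D(X)_Y`, generated by the `(y; x_1, …, x_n)` with `x_i = x_{i+1}` for some `i`. -/
def degenerate (X : Type u) (Y : Type v) (n : ℕ) : AddSubgroup (RackChain X Y n) :=
  AddSubgroup.closure {c | ∃ (y : Y) (x : Fin n → X) (i j : Fin n),
    (j : ℕ) = i + 1 ∧ x i = x j ∧ c = FreeAbelianGroup.of (y, x)}

/-- `C_n^Q(X)_Y = C_n^R(X)_Y / C_n^D(X)_Y`. -/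
abbrev QuandleChain (X : Type u) (Y : Type v) (n : ℕ) :=
  RackChain X Y n ⧸ degenerate X Y n

/-- The class of the generator `(y; x_1, …, x_n)` in `C_n^Q(X)_Y`. -/
def gen {X : Type u} {Y : Type v} {n : ℕ} (y : Y) (x : Fin n → X) : QuandleChain X Y n :=
  QuotientAddGroup.mk (FreeAbelianGroup.of (y, x))

/-- The face `(y; x_1, …, x_{i-1}, x_{i+1}, …, x_n)`. -/
def face0 {X : Type u} {Y : Type v} {n : ℕ} (i : Fin (n + 1)) (c : Y × (Fin (n + 1) → X)) :
    Y × (Fin n → X) :=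
  (c.1, fun j => c.2 (i.succAbove j))

/-- The face `(y · x_i; x_1 * x_i, …, x_{i-1} * x_i, x_{i+1}, …, x_n)`. -/
def face1 {X : Type u} [Quandle X] {Y : Type v} [XSet X Y] {n : ℕ} (i : Fin (n + 1))
    (c : Y × (Fin (n + 1) → X)) : Y × (Fin n → X) :=
  (MulOpposite.op (As.of (c.2 i)) • c.1, fun j =>
    if i.succAbove j < i then qop (c.2 (i.succAbove j)) (c.2 i) else c.2 (i.succAbove j))

/-- `∂_n^0` on `C_n^R(X)_Y`; as `i` starts at `0` here, the sign of the `i`-th face is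
`(-1)^(i+1)`. -/
def rackD0 (X : Type u) (Y : Type v) (n : ℕ) : RackChain X Y (n + 1) →+ RackChain X Y n :=
  FreeAbelianGroup.lift fun c =>
    ∑ i : Fin (n + 1), (-1 : ℤ) ^ ((i : ℕ) + 1) • FreeAbelianGroup.of (face0 i c)

/-- `∂_n^1` on `C_n^R(X)_Y`. -/
def rackD1 (X : Type u) [Quandle X] (Y : Type v) [XSet X Y] (n : ℕ) :
    RackChain X Y (n + 1) →+ RackChain X Y n :=
  FreeAbelianGroup.lift fun c =>
    ∑ i : Fin (n + 1), (-1 : ℤ) ^ ((i : ℕ) + 1) • FreeAbelianGroup.of (face1 i c)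

theorem alternating_mem {M : Type*} [AddCommGroup M] (S : AddSubgroup M) {n : ℕ}
    (F : Fin (n + 1) → M) (i j : Fin (n + 1)) (hij : (j : ℕ) = i + 1) (hF : F i = F j)
    (h : ∀ k, k ≠ i → k ≠ j → F k ∈ S) :
    ∑ k : Fin (n + 1), (-1 : ℤ) ^ ((k : ℕ) + 1) • F k ∈ S := by
  classical
  have hne : i ≠ j := by
    intro e; rw [e] at hij; omega
  rw [← Finset.add_sum_erase _ _ (Finset.mem_univ i),
    ← Finset.add_sum_erase _ _ (Finset.mem_erase.2 ⟨hne.symm, Finset.mem_univ j⟩), ← add_assoc]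
  have h0 : (-1 : ℤ) ^ ((i : ℕ) + 1) • F i + (-1 : ℤ) ^ ((j : ℕ) + 1) • F j = 0 := by
    rw [hF, hij, pow_succ _ ((i : ℕ) + 1)]
    simp
  rw [h0, zero_add]
  refine S.sum_mem fun k hk => S.zsmul_mem (h k ?_ ?_) _
  · exact (Finset.mem_erase.1 (Finset.mem_erase.1 hk).2).1
  · exact (Finset.mem_erase.1 hk).1

/-- A pair of consecutive indices both different from `k` stays consecutive when `k` is
removed, on the same side of `k`. -/
theorem exists_succAbove_pair {n : ℕ} (i j k : Fin (n + 1)) (hij : (j : ℕ) = i + 1)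
    (hi : k ≠ i) (hj : k ≠ j) :
    ∃ a b : Fin n, (b : ℕ) = a + 1 ∧ k.succAbove a = i ∧ k.succAbove b = j ∧ (i < k ↔ j < k) := by
  obtain ⟨a, ha⟩ := Fin.exists_succAbove_eq hi.symm
  obtain ⟨b, hb⟩ := Fin.exists_succAbove_eq hj.symm
  refine ⟨a, b, ?_, ha, hb, ?_⟩
  · subst ha hb
    simp only [Fin.succAbove, Fin.lt_def, ne_eq, Fin.ext_iff] at *
    split_ifs at * <;> simp at * <;> omega
  · simp only [Fin.lt_def, ne_eq, Fin.ext_iff] at *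
    omega

theorem succAbove_pair_cases {n : ℕ} (i j : Fin (n + 1)) (hij : (j : ℕ) = i + 1) (a : Fin n) :
    (i.succAbove a = j.succAbove a ∧ (i.succAbove a < i ↔ j.succAbove a < j)) ∨
    (i.succAbove a = j ∧ j.succAbove a = i) := by
  simp only [Fin.succAbove, Fin.lt_def, Fin.ext_iff] at *
  split_ifs at * <;> simp at * <;> omega

theorem rackD0_degenerate (X : Type u) (Y : Type v) (n : ℕ) :
    degenerate X Y (n + 1) ≤ (degenerate X Y n).comap (rackD0 X Y n) := by
  rw [degenerate, AddSubgroup.closure_le]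
  rintro _ ⟨y, x, i, j, hij, hx, rfl⟩
  rw [SetLike.mem_coe, AddSubgroup.mem_comap, rackD0, FreeAbelianGroup.lift_apply_of]
  refine alternating_mem _ (fun k => FreeAbelianGroup.of (face0 k (y, x))) i j hij ?_ ?_
  · refine congrArg FreeAbelianGroup.of (Prod.ext rfl (funext fun a => ?_))
    rcases succAbove_pair_cases i j hij a with h | h
    · simp only [face0, h.1]
    · simp only [face0, h.1, h.2, hx]
  · intro k hi hj
    obtain ⟨a, b, hab, ha, hb, -⟩ := exists_succAbove_pair i j k hij hi hj
    exact AddSubgroup.subset_closure ⟨_, _, a, b, hab, by simp only [ha, hb, hx], rfl⟩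

theorem rackD1_degenerate (X : Type u) [Quandle X] (Y : Type v) [XSet X Y] (n : ℕ) :
    degenerate X Y (n + 1) ≤ (degenerate X Y n).comap (rackD1 X Y n) := by
  rw [degenerate, AddSubgroup.closure_le]
  rintro _ ⟨y, x, i, j, hij, hx, rfl⟩
  rw [SetLike.mem_coe, AddSubgroup.mem_comap, rackD1, FreeAbelianGroup.lift_apply_of]
  refine alternating_mem _ (fun k => FreeAbelianGroup.of (face1 k (y, x))) i j hij ?_ ?_
  · refine congrArg FreeAbelianGroup.of (Prod.ext ?_ (funext fun a => ?_))
    · simp only [face1, hx]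
    · rcases succAbove_pair_cases i j hij a with h | h
      · simp only [face1, h.1, hx]
        simp only [← h.1, h.2]
      · simp only [face1, h.1, h.2, hx, qop, Quandle.fix, ite_self]
  · intro k hi hj
    obtain ⟨a, b, hab, ha, hb, hlt⟩ := exists_succAbove_pair i j k hij hi hj
    exact AddSubgroup.subset_closure ⟨_, _, a, b, hab, by simp only [ha, hb, hx, hlt], rfl⟩

/-- `∂_{n+1}^0 : C_{n+1}^Q(X)_Y → C_n^Q(X)_Y`. -/
def d0 (X : Type u) (Y : Type v) (n : ℕ) : QuandleChain X Y (n + 1) →+ QuandleChain X Y n :=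
  QuotientAddGroup.map _ _ (rackD0 X Y n) (rackD0_degenerate X Y n)

/-- `∂_{n+1}^1 : C_{n+1}^Q(X)_Y → C_n^Q(X)_Y`. -/
def d1 (X : Type u) [Quandle X] (Y : Type v) [XSet X Y] (n : ℕ) :
    QuandleChain X Y (n + 1) →+ QuandleChain X Y n :=
  QuotientAddGroup.map _ _ (rackD1 X Y n) (rackD1_degenerate X Y n)

/-- The boundary map `∂_{n+1} = ∂_{n+1}^0 - ∂_{n+1}^1`. -/
def boundary (X : Type u) [Quandle X] (Y : Type v) [XSet X Y] (n : ℕ) :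
    QuandleChain X Y (n + 1) →+ QuandleChain X Y n :=
  d0 X Y n - d1 X Y n

/-- `C^n_Q(X;A)_Y = Hom(C_n^Q(X)_Y, A)`. -/
abbrev Cochain (X : Type u) (Y : Type v) (A : Type w) [AddCommGroup A] (n : ℕ) :=
  QuandleChain X Y n →+ A

/-- The cocycle group `Z^n_Q(X;A)_Y`. -/
def cocycles (X : Type u) [Quandle X] (Y : Type v) [XSet X Y] (A : Type w) [AddCommGroup A]
    (n : ℕ) : AddSubgroup (Cochain X Y A n) where
  carrier := {f | f.comp (boundary X Y n) = 0}
  zero_mem' := AddMonoidHom.zero_comp _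
  add_mem' := by
    intro f g hf hg
    simp only [Set.mem_ofPred_eq] at *
    rw [AddMonoidHom.add_comp, hf, hg, add_zero]
  neg_mem' := by
    intro f hf
    simp only [Set.mem_ofPred_eq] at *
    rw [AddMonoidHom.neg_comp, hf, neg_zero]

/-- The chain map `(y; x_1, …, x_n) ↦ (p y; f x_1, …, f x_n)`. It is `f_♯` for a quandle
homomorphism `f` and `p = As(f)`, and `p_♯` for an `X`-map `p` and `f = id`. -/
def inducedMap {Q : Type u} {X : Type v} {Y Z : Type*} (p : Y → Z) (f : Q → X) (n : ℕ) :
    QuandleChain Q Y n →+ QuandleChain X Z n :=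
  QuotientAddGroup.map _ _
    (FreeAbelianGroup.map fun c : Y × (Fin n → Q) => ((p c.1, f ∘ c.2) : Z × (Fin n → X))) (by
      rw [degenerate, AddSubgroup.closure_le]
      rintro _ ⟨y, x, i, j, hij, hx, rfl⟩
      refine AddSubgroup.subset_closure ⟨p y, f ∘ x, i, j, hij, by simp [hx], ?_⟩
      exact FreeAbelianGroup.map_of_apply _)

/-- The (non-generalized) quandle chain groups `C_n^Q(X)`, `n ≥ 1`, are those of the `X`-set with
one element; this is the shifting map `σ_{n+1} = (-1)^{n+1} ∂_{n+1}^0` on them. -/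
def shift (X : Type u) (n : ℕ) : QuandleChain X Unit (n + 1) →+ QuandleChain X Unit n :=
  (-1 : ℤ) ^ (n + 1) • d0 X Unit n

/-- The pull-back `σ^♯`. -/
def shiftPullback {X : Type u} {A : Type w} [AddCommGroup A] {n : ℕ} (f : Cochain X Unit A n) :
    Cochain X Unit A (n + 1) :=
  f.comp (shift X n)

/-- `ι_n : C_n^Q(X)_X → C_{n+1}^Q(X)`, `(x_0; x_1, …, x_n) ↦ (-1)^n (x_0, x_1, …, x_n)`. -/
def iota (X : Type u) (n : ℕ) : QuandleChain X X n →+ QuandleChain X Unit (n + 1) :=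
  (-1 : ℤ) ^ n • QuotientAddGroup.map _ _
    (FreeAbelianGroup.map fun c : X × (Fin n → X) =>
      (((), Fin.cons c.1 c.2) : Unit × (Fin (n + 1) → X))) (by
      rw [degenerate, AddSubgroup.closure_le]
      rintro _ ⟨y, x, i, j, hij, hx, rfl⟩
      refine AddSubgroup.subset_closure ⟨(), Fin.cons y x, i.succ, j.succ, by simp [hij],
        by simp [hx], ?_⟩
      exact FreeAbelianGroup.map_of_apply _)

/-- The pull-back `ι^♯`. -/
def iotaPullback {X : Type u} {A : Type w} [AddCommGroup A] {n : ℕ}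
    (f : Cochain X Unit A (n + 1)) : Cochain X X A n :=
  f.comp (iota X n)

/-! ### Quandles given by generators and relations -/

/-- Formal quandle words in the generators `α`. -/
inductive QWord (α : Type u) : Type u
  | of (a : α) : QWord α
  | act (x y : QWord α) : QWord α
  | invAct (x y : QWord α) : QWord α

/-- The smallest congruence that forces the quandle axioms and the relations `a * b = c`, for all
generators `a`, `b`, `c` with `r a b c`. -/
inductive QWord.Rel {α : Type u} (r : α → α → α → Prop) : QWord α → QWord α → Prop
  | refl (x) : Rel r x x
  | symm {x y} : Rel r x y → Rel r y x
  | trans {x y z} : Rel r x y → Rel r y z → Rel r x z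
  | act_congr {x x' y y'} : Rel r x x' → Rel r y y' → Rel r (.act x y) (.act x' y')
  | invAct_congr {x x' y y'} : Rel r x x' → Rel r y y' → Rel r (.invAct x y) (.invAct x' y')
  | self_distrib (x y z) : Rel r (.act x (.act y z)) (.act (.act x y) (.act x z))
  | left_inv (x y) : Rel r (.invAct x (.act x y)) y
  | right_inv (x y) : Rel r (.act x (.invAct x y)) y
  | fix (x) : Rel r (.act x x) x
  | rel {a b c} : r a b c → Rel r (.act (.of b) (.of a)) (.of c)

/-- The congruence as a setoid. -/
def QWord.setoid {α : Type u} (r : α → α → α → Prop) : Setoid (QWord α) :=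
  ⟨QWord.Rel r, .refl, .symm, .trans⟩

/-- The quandle generated by `α` with a relation `a * b = c` whenever `r a b c`. -/
def PresentedQuandle {α : Type u} (r : α → α → α → Prop) : Type u := Quotient (QWord.setoid r)

/-- The class of a word. -/
def PresentedQuandle.mk {α : Type u} (r : α → α → α → Prop) (x : QWord α) : PresentedQuandle r :=
  Quotient.mk (QWord.setoid r) x

/-- The generator of the presented quandle given by `a`. -/
def PresentedQuandle.of {α : Type u} (r : α → α → α → Prop) (a : α) : PresentedQuandle r :=
  PresentedQuandle.mk r (.of a)

instance {α : Type u} (r : α → α → α → Prop) : Quandle (PresentedQuandle r) where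
  act := Quotient.map₂ QWord.act fun _ _ h _ _ h' => QWord.Rel.act_congr h h'
  invAct := Quotient.map₂ QWord.invAct fun _ _ h _ _ h' => QWord.Rel.invAct_congr h h'
  self_distrib := by
    rintro ⟨x⟩ ⟨y⟩ ⟨z⟩
    exact Quotient.sound (QWord.Rel.self_distrib x y z)
  left_inv := by
    rintro ⟨x⟩ ⟨y⟩
    exact Quotient.sound (QWord.Rel.left_inv x y)
  right_inv := by
    rintro ⟨x⟩ ⟨y⟩
    exact Quotient.sound (QWord.Rel.right_inv x y)
  fix := by
    rintro ⟨x⟩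
    exact Quotient.sound (QWord.Rel.fix x)

theorem PresentedQuandle.hom_ext {α : Type u} (r : α → α → α → Prop) {X : Type v} [Quandle X]
    {f g : PresentedQuandle r →◃ X}
    (h : ∀ a, f (PresentedQuandle.of r a) = g (PresentedQuandle.of r a)) : f = g := by
  have key : ∀ x : QWord α, f (PresentedQuandle.mk r x) = g (PresentedQuandle.mk r x) := by
    intro x
    induction x with
    | of a => exact h a
    | act x y hx hy =>
      have e : PresentedQuandle.mk r (.act x y) =
        PresentedQuandle.mk r x ◃ PresentedQuandle.mk r y := rfl
      rw [e, ShelfHom.map_act, ShelfHom.map_act, hx, hy]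
    | invAct x y hx hy =>
      have e : PresentedQuandle.mk r x ◃ PresentedQuandle.mk r (.invAct x y) =
          PresentedQuandle.mk r y :=
        Quotient.sound (s := QWord.setoid r) (QWord.Rel.right_inv x y)
      have h1 := ShelfHom.map_act f (x := PresentedQuandle.mk r x)
        (y := PresentedQuandle.mk r (.invAct x y))
      have h2 := ShelfHom.map_act g (x := PresentedQuandle.mk r x)
        (y := PresentedQuandle.mk r (.invAct x y))
      rw [e] at h1 h2
      rw [hy, hx] at h1
      exact (Rack.left_cancel _).1 (h1.symm.trans h2)
  apply ShelfHom.ext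
  funext x
  induction x using Quotient.inductionOn with
  | h x => exact key x

instance {α : Type u} [Finite α] (r : α → α → α → Prop) {X : Type v} [Quandle X] [Finite X] :
    Finite (PresentedQuandle r →◃ X) :=
  Finite.of_injective (fun f => fun a => f (PresentedQuandle.of r a))
    fun _ _ h => PresentedQuandle.hom_ext r (congrFun h)

/-! ### Links and link diagrams -/

/-- The plane `ℝ²`. -/
abbrev Plane := ℝ × ℝ

/-- The space `ℝ³ = ℝ² × ℝ`; the second factor is the height over the plane. -/
abbrev Space := Plane × ℝ

/-- An oriented classical link: finitely many disjoint embedded oriented circles in `ℝ³`. -/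
structure OrientedLink where
  numComponents : ℕ
  toFun : Fin numComponents × Circle → Space
  continuous' : Continuous toFun
  injective' : Function.Injective toFun

/-- An oriented polygonal link: finitely many vertices, each with its successor, and the oriented
edges `[pos v, pos (next v)]`. Each point of the link lies on exactly one half-open edge
`[pos v, pos (next v))`, at exactly one time. -/
structure PolygonalLink where
  n : ℕ
  next : Equiv.Perm (Fin n)
  pos : Fin n → Space
  injective' : Function.Injective fun P : Fin n × Set.Ico (0 : ℝ) 1 =>
    AffineMap.lineMap (k := ℝ) (pos P.1) (pos (next P.1)) (P.2 : ℝ)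

namespace PolygonalLink

variable (D : PolygonalLink)

/-- The parameter space of the link: an edge and a time in `[0, 1)`. -/
abbrev Param := Fin D.n × Set.Ico (0 : ℝ) 1

/-- The point at time `t` on the edge that starts at the vertex `v`. -/
def edgePoint (v : Fin D.n) (t : ℝ) : Space := AffineMap.lineMap (D.pos v) (D.pos (D.next v)) t

/-- The point of the link with a given parameter. -/
def point (P : D.Param) : Space := D.edgePoint P.1 P.2

/-- The link as a subset of `ℝ³`. -/
def carrier : Set Space := Set.range D.point

/-- The direction of the projection of the edge that starts at `v`. -/
def dir (v : Fin D.n) : Plane := (D.pos (D.next v)).1 - (D.pos v).1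

/-- The normal vector of the projection of the edge that starts at `v`: the direction of the edge
rotated counterclockwise by a right angle. -/
def normal (v : Fin D.n) : Plane := (-(D.dir v).2, (D.dir v).1)

end PolygonalLink

/-- A link diagram: a polygonal link in regular position with respect to the vertical
projection `ℝ³ → ℝ²`. No three points of the link have the same projection, and no vertex has the
same projection as another point. -/
structure LinkDiagram extends PolygonalLink where
  double' : ∀ P Q R : toPolygonalLink.Param,
    (toPolygonalLink.point P).1 = (toPolygonalLink.point Q).1 →
    (toPolygonalLink.point Q).1 = (toPolygonalLink.point R).1 → P = Q ∨ Q = R ∨ P = R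
  vertex' : ∀ (v : Fin n) (P : toPolygonalLink.Param),
    (toPolygonalLink.point P).1 = (pos v).1 → P = (v, ⟨0, le_refl _, one_pos⟩)

namespace LinkDiagram

variable (D : LinkDiagram)

/-- `D` is a diagram of `L`: an ambient isotopy of `ℝ³` takes `L` to the polygonal link of `D`,
and each oriented edge of `D` then runs along a component of `L` in the positive direction. -/
def IsDiagramOf (L : OrientedLink) : Prop :=
  ∃ H : unitInterval → (Space ≃ₜ Space),
    Continuous (fun z : unitInterval × Space => H z.1 z.2) ∧
    H 0 = Homeomorph.refl Space ∧
    Set.range (fun z => H 1 (L.toFun z)) = D.carrier ∧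
    ∀ v : Fin D.n, ∃ (j : Fin L.numComponents) (θ : ℝ → ℝ),
      ContinuousOn θ (Set.Icc 0 1) ∧ StrictMonoOn θ (Set.Icc 0 1) ∧
      ∀ t ∈ Set.Icc (0 : ℝ) 1, H 1 (L.toFun (j, Circle.exp (θ t))) = D.edgePoint v t

/-- A crossing of `D`: two points of the link, one above the other. -/
structure Crossing where
  upper : D.Param
  lower : D.Param
  proj_eq : (D.point upper).1 = (D.point lower).1
  lt : (D.point lower).2 < (D.point upper).2

/-- The points of the link over which another point of the link lies. -/
def underPoints : Set Space := {q | ∃ τ : D.Crossing, D.point τ.lower = q}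

/-- The arcs of `D`: the pieces into which the under-crossing points cut the link. -/
abbrev Arc := ConnectedComponents {q : Space // q ∈ D.carrier ∧ q ∉ D.underPoints}

/-- The point `q` of `ℝ³` lies on the arc `a`. -/
def OnArc (q : Space) (a : D.Arc) : Prop :=
  ∃ h : q ∈ D.carrier ∧ q ∉ D.underPoints, ConnectedComponents.mk ⟨q, h⟩ = a

/-- The projection of the link to the plane. -/
def shadow : Set Plane := Prod.fst '' D.carrier

/-- The regions of `D`: the connected components of the complement of its projection. -/
abbrev Region := ConnectedComponents {q : Plane // q ∉ D.shadow}

/-- The point `q` of the plane lies in the region `r`. -/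
def InRegion (q : Plane) (r : D.Region) : Prop :=
  ∃ h : q ∉ D.shadow, ConnectedComponents.mk ⟨q, h⟩ = r

theorem point_injective : Function.Injective D.point := D.injective'

theorem over_not_under (τ : D.Crossing) : D.point τ.upper ∉ D.underPoints := by
  rintro ⟨τ', h⟩
  have h1 := D.point_injective h
  rcases D.double' τ'.upper τ'.lower τ.lower τ'.proj_eq (by rw [h1]; exact τ.proj_eq) with e | e | e
  · exact (e ▸ τ'.lt).ne rfl
  · exact (τ.lt).ne (by rw [← e, h1])
  · have a := τ'.lt
    rw [e, h1] at a
    exact lt_asymm a τ.lt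

instance : Nonempty D.Region := by
  have hc : IsCompact (⋃ v : Fin D.n, (fun t => (D.edgePoint v t).1) '' Set.Icc (0 : ℝ) 1) := by
    refine isCompact_iUnion fun v => isCompact_Icc.image ?_
    unfold PolygonalLink.edgePoint
    exact continuous_fst.comp AffineMap.lineMap_continuous
  have hs : D.shadow ≠ Set.univ := by
    intro h
    refine noncompact_univ Plane (hc.of_isClosed_subset isClosed_univ ?_)
    rw [← h]
    rintro _ ⟨_, ⟨P, rfl⟩, rfl⟩
    exact Set.mem_iUnion.2 ⟨P.1, P.2, ⟨P.2.2.1, P.2.2.2.le⟩, rfl⟩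
  obtain ⟨q, hq⟩ := (Set.ne_univ_iff_exists_notMem _).1 hs
  exact ⟨ConnectedComponents.mk ⟨q, hq⟩⟩

namespace Crossing

variable {D} (τ : D.Crossing)

/-- The point of the plane at which the crossing lies. -/
def center : Plane := (D.point τ.upper).1

/-- The direction of the over strand. -/
def overDir : Plane := D.dir τ.upper.1

/-- The direction of the under strand. -/
def underDir : Plane := D.dir τ.lower.1

/-- The sign of the crossing: it is positive if the directions of the over strand and of the under
strand, in this order, form a positive basis of the plane. -/
def sign : ℤ :=
  if 0 < τ.overDir.1 * τ.underDir.2 - τ.overDir.2 * τ.underDir.1 then 1 else -1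

/-- The over arc. -/
def overArc : D.Arc :=
  ConnectedComponents.mk ⟨D.point τ.upper, ⟨_, rfl⟩, D.over_not_under τ⟩

/-- `a` is the under arc from which the normal vector of the over arc points. (The under strand
runs in the direction of this normal vector if and only if the crossing is positive.) -/
def IsSourceArc (a : D.Arc) : Prop :=
  ∀ᶠ δ : ℝ in 𝓝[>] 0, D.OnArc (D.edgePoint τ.lower.1 (τ.lower.2 - τ.sign * δ)) a

/-- `a` is the under arc to which the normal vector of the over arc points. -/
def IsTargetArc (a : D.Arc) : Prop :=
  ∀ᶠ δ : ℝ in 𝓝[>] 0, D.OnArc (D.edgePoint τ.lower.1 (τ.lower.2 + τ.sign * δ)) a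

/-- The specified region: the one among the four around the crossing from which the
normal vectors of both strands point. The vector `sign • (overDir - underDir)` has a negative
scalar product with both normal vectors. -/
def IsSpecifiedRegion (r : D.Region) : Prop :=
  ∀ᶠ δ : ℝ in 𝓝[>] 0,
    D.InRegion (τ.center + (δ * (τ.sign : ℝ)) • (τ.overDir - τ.underDir)) r

theorem nonempty_arc (τ : D.Crossing) : Nonempty D.Arc := ⟨τ.overArc⟩

/-- The under arc from which the normal vector of the over arc points. -/
def sourceArc : D.Arc := @Classical.epsilon _ τ.nonempty_arc τ.IsSourceArc

/-- The specified region of the crossing. -/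
def specifiedRegion : D.Region := Classical.epsilon τ.IsSpecifiedRegion

end Crossing

/-- At each crossing, the relation `a * b = c` with the over arc `b`, whose normal vector points
from the under arc `a` to the under arc `c`. -/
def crossingRel (a b c : D.Arc) : Prop :=
  ∃ τ : D.Crossing, τ.IsSourceArc a ∧ b = τ.overArc ∧ τ.IsTargetArc c

/-- The fundamental quandle `Q_D`, generated by the arcs. -/
abbrev FundamentalQuandle : Type := PresentedQuandle D.crossingRel

/-- An arc as an element of the fundamental quandle. -/
def arcGen (a : D.Arc) : D.FundamentalQuandle := PresentedQuandle.of D.crossingRel a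

/-- The characterization of the map `c^R` from the regions to `As(Q_D)`: the unbounded region
goes to the identity, and `c^R(r₁) · a = c^R(r₂)` whenever the normal vector of the arc `a`, at some
point of `a` that is neither a vertex nor a crossing point, points from `r₁` to `r₂`. -/
structure IsRegionMap (c : D.Region → As D.FundamentalQuandle) : Prop where
  unbounded : ∀ r, ¬ Bornology.IsBounded {q | D.InRegion q r} → c r = 1
  mul_arc : ∀ (P : D.Param) (a : D.Arc) (r₁ r₂ : D.Region), 0 < (P.2 : ℝ) →
    (∀ Q : D.Param, (D.point Q).1 = (D.point P).1 → Q = P) → D.OnArc (D.point P) a →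
    (∀ᶠ δ : ℝ in 𝓝[>] 0, D.InRegion ((D.point P).1 - δ • D.normal P.1) r₁) →
    (∀ᶠ δ : ℝ in 𝓝[>] 0, D.InRegion ((D.point P).1 + δ • D.normal P.1) r₂) →
    c r₁ * As.of (D.arcGen a) = c r₂

/-- The unique map `c^R` from the regions to `As(Q_D)`. -/
def regionMap : D.Region → As D.FundamentalQuandle := Classical.epsilon D.IsRegionMap

/-- The weight `ε(τ) (r; x, y)` of a crossing, with the specified region `r`, the under arc `x`
facing `r` (from which the normal vector of the over arc points) and the over arc `y`. -/
def weight (τ : D.Crossing) : QuandleChain D.FundamentalQuandle (As D.FundamentalQuandle) 2 :=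
  τ.sign • gen (D.regionMap τ.specifiedRegion) ![D.arcGen τ.sourceArc, D.arcGen τ.overArc]

theorem dir_ne_zero (v : Fin D.n) : D.dir v ≠ 0 := by
  intro h
  have key : ∀ t : Set.Ico (0 : ℝ) 1, (D.point (v, t)).1 = (D.pos v).1 := by
    intro t
    have : (D.point (v, t)).1 = (D.pos v).1 + (t : ℝ) • D.dir v := by
      simp [PolygonalLink.point, PolygonalLink.edgePoint, PolygonalLink.dir,
        AffineMap.lineMap_apply, add_comm]
    rw [this, h, smul_zero, add_zero]
  have := D.vertex' v (v, ⟨1 / 2, by norm_num, by norm_num⟩) (key _)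
  have h0 := congrArg (fun z => (z.2 : ℝ)) this
  norm_num at h0

theorem point_fst (P : D.Param) : (D.point P).1 = (D.pos P.1).1 + (P.2 : ℝ) • D.dir P.1 := by
  simp [PolygonalLink.point, PolygonalLink.edgePoint, PolygonalLink.dir,
    AffineMap.lineMap_apply, add_comm]

theorem next_fst (v : Fin D.n) : (D.pos (D.next v)).1 = (D.pos v).1 + D.dir v := by
  simp [PolygonalLink.dir]

theorem two_cycle (v : Fin D.n) (h : D.next (D.next v) = v) : False := by
  have hh : (1 / 2 : ℝ) ∈ Set.Ico (0 : ℝ) 1 := by norm_num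
  have h1 : D.point (v, ⟨1 / 2, hh⟩) = D.point (D.next v, ⟨1 / 2, hh⟩) := by
    simp only [PolygonalLink.point, PolygonalLink.edgePoint, h]
    rw [AffineMap.lineMap_apply_module, AffineMap.lineMap_apply_module, add_comm]
    norm_num
  have h2 := congrArg Prod.fst (D.point_injective h1)
  have h3 : D.next v = v := h2.symm
  have h4 := D.dir_ne_zero v
  apply h4
  simp [PolygonalLink.dir, h3]

/-- The projections of two different edges meet at most once. -/
theorem meet_unique (v w : Fin D.n) (hvw : v ≠ w) (t₁ t₂ s₁ s₂ : Set.Ico (0 : ℝ) 1)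
    (h₁ : (D.point (v, t₁)).1 = (D.point (w, s₁)).1)
    (h₂ : (D.point (v, t₂)).1 = (D.point (w, s₂)).1) : t₁ = t₂ ∧ s₁ = s₂ := by
  have hd := D.dir_ne_zero v
  have he := D.dir_ne_zero w
  rw [D.point_fst, D.point_fst] at h₁ h₂
  simp only at h₁ h₂
  have hs : t₁ = t₂ → s₁ = s₂ := by
    rintro rfl
    have : ((s₁ : ℝ) - s₂) • D.dir w = 0 := by
      have := h₁.symm.trans h₂
      rw [sub_smul, sub_eq_zero]
      exact add_left_cancel this
    rcases smul_eq_zero.1 this with h | h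
    · exact Subtype.ext (by linarith)
    · exact absurd h he
  by_contra hne
  have ht : t₁ ≠ t₂ := fun h => hne ⟨h, hs h⟩
  have ht' : (t₁ : ℝ) - t₂ ≠ 0 := fun h => ht (Subtype.ext (by linarith))
  have hdd : ((t₁ : ℝ) - t₂) • D.dir v = ((s₁ : ℝ) - s₂) • D.dir w := by
    have := congrArg₂ (· - ·) h₁ h₂
    simp only [add_sub_add_left_eq_sub, ← sub_smul] at this
    exact this
  have hs' : (s₁ : ℝ) - s₂ ≠ 0 := by
    intro h
    rw [h, zero_smul] at hdd
    rcases smul_eq_zero.1 hdd with h | h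
    · exact ht' h
    · exact hd h
  obtain ⟨k, hk0, hwk⟩ : ∃ k : ℝ, k ≠ 0 ∧ D.dir w = k • D.dir v := by
    refine ⟨((t₁ : ℝ) - t₂) / (s₁ - s₂), div_ne_zero ht' hs', ?_⟩
    rw [div_eq_inv_mul, mul_smul, hdd, inv_smul_smul₀ hs']
  set τ : ℝ := t₁ - k * s₁ with hτ
  have hw : (D.pos w).1 = (D.pos v).1 + τ • D.dir v := by
    rw [hτ, sub_smul, mul_comm, mul_smul, ← hwk, ← add_sub_assoc, h₁, add_sub_cancel_right]
  have hpw : ∀ s : Set.Ico (0 : ℝ) 1,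
      (D.point (w, s)).1 = (D.pos v).1 + (τ + k * s) • D.dir v := by
    intro s
    rw [D.point_fst]
    simp only
    rw [hw, hwk, add_assoc, smul_smul, ← add_smul, mul_comm (s : ℝ)]
  -- a vertex of one edge cannot lie on the other one
  have hA : ¬ (0 ≤ τ ∧ τ < 1) := by
    intro h
    have := D.vertex' w (v, ⟨τ, h.1, h.2⟩) (by rw [D.point_fst, hw])
    exact hvw (congrArg Prod.fst this)
  have hB : ∀ s : ℝ, 0 ≤ s → s < 1 → τ + k * s ≠ 0 := by
    intro s h0 h1 h
    have := D.vertex' v (w, ⟨s, h0, h1⟩) (by rw [hpw]; simp [h])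
    exact hvw (congrArg Prod.fst this).symm
  have b1 := t₁.2.1
  have b2 := t₁.2.2
  have c1 := s₁.2.1
  have c2 := s₁.2.2
  have ht1 : (t₁ : ℝ) = τ + k * s₁ := by rw [hτ]; ring
  rcases lt_or_gt_of_ne hk0 with hk | hkp
  · have hτ1 : 1 ≤ τ := by
      by_contra h
      exact hA ⟨by nlinarith, not_le.1 h⟩
    have hsk : 0 ≤ (1 - τ) / k := div_nonneg_of_nonpos (by linarith) hk.le
    have hsk1 : (1 - τ) / k < 1 := by
      rw [div_lt_one_of_neg hk]
      nlinarith
    have hmul : k * ((1 - τ) / k) = 1 - τ := by field_simp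
    have hv := D.vertex' (D.next v) (w, ⟨(1 - τ) / k, hsk, hsk1⟩) (by
      rw [hpw, D.next_fst]; simp [hmul])
    have hwv : w = D.next v := congrArg Prod.fst hv
    have h0 : (1 - τ) / k = 0 := congrArg (fun z => (z.2 : ℝ)) hv
    have hτe : τ = 1 := by
      rw [h0, mul_zero] at hmul
      linarith
    rcases lt_trichotomy k (-1) with h | h | h
    · refine hB (-1 / k) ?_ ?_ ?_
      · exact div_nonneg_of_nonpos (by norm_num) hk.le
      · rw [div_lt_one_of_neg hk]; exact h
      · rw [hτe]; field_simp; norm_num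
    · have hv := D.vertex' (D.next w) (v, ⟨0, le_refl _, one_pos⟩) (by
        rw [D.next_fst, hw, hwk, hτe, h, D.point_fst]; simp)
      have h5 : v = D.next w := congrArg Prod.fst hv
      exact D.two_cycle v (by rw [← hwv, ← h5])
    · have hv := D.vertex' (D.next w) (v, ⟨1 + k, by linarith, by linarith⟩) (by
        rw [D.next_fst, hw, hwk, hτe, D.point_fst]; simp [add_smul, add_assoc])
      have h5 : 1 + k = 0 := congrArg (fun z => (z.2 : ℝ)) hv
      linarith
  · rcases le_or_gt 0 τ with h | h
    · exact hA ⟨h, by nlinarith⟩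
    · refine hB (-τ / k) (div_nonneg (by linarith) hkp.le) ?_ ?_
      · rw [div_lt_one hkp]; nlinarith
      · field_simp; ring

theorem Crossing.fst_ne (τ : D.Crossing) : τ.upper.1 ≠ τ.lower.1 := by
  intro h
  have h1 := τ.proj_eq
  rw [D.point_fst, D.point_fst, h] at h1
  have h2 : ((τ.upper.2 : ℝ) - τ.lower.2) • D.dir τ.lower.1 = 0 := by
    rw [sub_smul, sub_eq_zero]
    exact add_left_cancel h1
  rcases smul_eq_zero.1 h2 with h3 | h3
  · have : τ.upper = τ.lower := Prod.ext h (Subtype.ext (by linarith))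
    exact (this ▸ τ.lt).ne rfl
  · exact D.dir_ne_zero _ h3

instance : Finite D.Crossing :=
  Finite.of_injective (fun τ : D.Crossing => (τ.upper.1, τ.lower.1)) (by
    rintro ⟨⟨v, t⟩, ⟨w, s⟩, h, hl⟩ ⟨⟨v', t'⟩, ⟨w', s'⟩, h', hl'⟩ e
    simp only [Prod.mk.injEq] at e
    obtain ⟨rfl, rfl⟩ := e
    obtain ⟨rfl, rfl⟩ := D.meet_unique _ _ (Crossing.fst_ne D ⟨_, _, h, hl⟩) _ _ _ _ h h'
    rfl)

instance : Fintype D.Crossing := Fintype.ofFinite _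

instance : Finite D.Arc := by
  classical
  let S := {q : Space // q ∈ D.carrier ∧ q ∉ D.underPoints}
  choose P hP using fun q : S => q.2.1
  let g : S → Fin D.n × Set D.Crossing := fun q =>
    ((P q).1, {τ | τ.lower.1 = (P q).1 ∧ (τ.lower.2 : ℝ) < (P q).2})
  have hg : ∀ q q' : S, g q = g q' → ((P q).2 : ℝ) ≤ (P q').2 →
      ConnectedComponents.mk q = ConnectedComponents.mk q' := by
    intro q q' h hle
    obtain ⟨h1, h2⟩ := Prod.mk.inj h
    have hmem : ∀ t : ℝ, t ∈ Set.Icc ((P q).2 : ℝ) (P q').2 →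
        D.edgePoint (P q).1 t ∈ D.carrier ∧ D.edgePoint (P q).1 t ∉ D.underPoints := by
      intro t ht
      have ht01 : t ∈ Set.Ico (0 : ℝ) 1 := ⟨(P q).2.2.1.trans ht.1, ht.2.trans_lt (P q').2.2.2⟩
      refine ⟨⟨((P q).1, ⟨t, ht01⟩), rfl⟩, ?_⟩
      rintro ⟨τ, hτ⟩
      have e : τ.lower = ((P q).1, ⟨t, ht01⟩) := D.point_injective hτ
      rcases ht.2.lt_or_eq with hlt | heq
      · have : τ ∈ {τ : D.Crossing | τ.lower.1 = (P q').1 ∧ (τ.lower.2 : ℝ) < (P q').2} := by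
          refine ⟨by rw [e, h1], by rw [e]; exact hlt⟩
        rw [← h2] at this
        have h3 : (τ.lower.2 : ℝ) < (P q).2 := this.2
        rw [e] at h3
        exact absurd ht.1 (not_le.2 h3)
      · refine q'.2.2 ⟨τ, ?_⟩
        rw [← hP q', e]
        have : ((P q).1, (⟨t, ht01⟩ : Set.Ico (0 : ℝ) 1)) = P q' :=
          Prod.ext h1 (Subtype.ext heq)
        rw [this]
    have hcont : Continuous fun t : Set.Icc ((P q).2 : ℝ) (P q').2 =>
        (⟨D.edgePoint (P q).1 t, hmem t t.2⟩ : S) := by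
      refine Continuous.subtype_mk ?_ _
      unfold PolygonalLink.edgePoint
      exact AffineMap.lineMap_continuous.comp continuous_subtype_val
    have : PreconnectedSpace (Set.Icc ((P q).2 : ℝ) (P q').2) :=
      isPreconnected_iff_preconnectedSpace.1 isPreconnected_Icc
    have hr := isPreconnected_range hcont
    refine ConnectedComponents.coe_eq_coe'.2 (hr.subset_connectedComponent
      (x := q') ⟨⟨_, Set.right_mem_Icc.2 hle⟩, ?_⟩ ⟨⟨_, Set.left_mem_Icc.2 hle⟩, ?_⟩)
    · refine Subtype.ext ?_
      change D.edgePoint (P q).1 (P q').2 = _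
      rw [← hP q', h1]; rfl
    · exact Subtype.ext (by rw [← hP q]; rfl)
  have hg' : ∀ q q' : S, g q = g q' → ConnectedComponents.mk q = ConnectedComponents.mk q' := by
    intro q q' h
    rcases le_total ((P q).2 : ℝ) (P q').2 with hle | hle
    · exact hg q q' h hle
    · exact (hg q' q h.symm hle).symm
  choose rep hrep using fun a : D.Arc => ConnectedComponents.surjective_coe a
  refine Finite.of_injective (fun a => g (rep a)) fun a b hab => ?_
  rw [← hrep a, ← hrep b]
  exact hg' _ _ hab

/-- The cycle `|D|`, the sum of the weights of all crossings; it represents the fundamental class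
`[D]`. -/
def fundamentalCycle : QuandleChain D.FundamentalQuandle (As D.FundamentalQuandle) 2 :=
  ∑ τ : D.Crossing, D.weight τ

/-! ### Cocycle invariants -/

instance (X : Type u) [Quandle X] [Finite X] : Fintype (D.FundamentalQuandle →◃ X) :=
  Fintype.ofFinite _

/-- The generalized quandle cocycle invariant `Ψ_λ^y(D) = ∑_c ⟨s^y_* c_* [D], [λ]⟩ ∈ ℤ[A]`. The
Kronecker product is the value of the cocycle on a cycle that represents the homology class. -/
def generalizedInvariant {X : Type u} [Quandle X] [Finite X] {A : Type w} [AddCommGroup A]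
    {Y : Type v} [XSet X Y] (lam : Cochain X Y A 2) (y : Y) : AddMonoidAlgebra ℤ A :=
  ∑ c : D.FundamentalQuandle →◃ X, AddMonoidAlgebra.single
    (lam (inducedMap (orbitMap X y) id 2 (inducedMap (As.map c) c 2 D.fundamentalCycle))) 1

/-- The quandle cocycle invariant `Φ_φ(D) ∈ ℤ[A]`. -/
def quandleCocycleInvariant {X : Type u} [Quandle X] [Finite X] {A : Type w} [AddCommGroup A]
    (φ : Cochain X Unit A 2) : AddMonoidAlgebra ℤ A :=
  D.generalizedInvariant φ ()

/-- The shadow cocycle invariant `Φ_θ^x(D) ∈ ℤ[A]`. -/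
def shadowCocycleInvariant {X : Type u} [Quandle X] [Finite X] {A : Type w} [AddCommGroup A]
    (θ : Cochain X Unit A 3) (x : X) : AddMonoidAlgebra ℤ A :=
  D.generalizedInvariant (iotaPullback θ) x

end LinkDiagram

end ShiftQuandle

end

open ShiftQuandle

noncomputable section

namespace ShiftQuandle

/-! Fix a colouring `c`. On a generator `(z; a, b)` the shadow cocycle is `φ(a,b) - φ(z,b) +
φ(z,a)`, and `φ(a,b)` is what the quandle cocycle invariant counts. So the invariants agree
colouring by colouring once `∑ ε(τ) (φ(x·r,b) - φ(x·r,a)) = 0`, where `r` is the value of the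
specified region of `τ`, `a` the colour of the under arc facing it and `b` the colour of the over
arc.

The cocycle condition lets `As(X)` act on the abelian extension `A × X` by `(s,z)·b = (s + φ(z,b), z
* b)`. Following `(0,x)` gives a function `p` on `As(X)` with `p(gb) = p(g) + φ(x·g,b)`
(`potential_mul_of`). Each summand thus becomes `ε(τ) (F(rb) - F(ra))`, a difference of one function
`F` at the two regions adjacent to `r`. Such a sum vanishes for every `F` (`sum_sign_smul_eq_zero`):
travel along the link and record `F` of the region on the right. The record changes only at
crossings, by `ε(F(r) - F(ra))` on the over strand and by `ε(F(rb) - F(r))` on the under strand.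
These two add up to the summand, and the total change along closed curves is zero.

The rest is plane topology. The region map is given by `Classical.epsilon`, so its existence must be
proved (`exists_isRegionMap`). Explicit solutions exist near every point (`exists_goodAt`), at a
crossing because of the relation `b⁻¹ab = c`. Two solutions on a connected open set differ by a
constant left factor (`exists_eq_mul`), so local solutions glue over rectangles and extend to the
plane (`solvable_univ`). Comparing the region map with the explicit solution at a crossing then
gives the changes stated above (`Crossing.eventually_rightVal`). -/

/-- A function that is locally constant off a set `Z` with dense complement is constant off `Z`
on every preconnected set. -/
theorem exists_const_of_isPreconnected {α β : Type*} [TopologicalSpace α] [Nonempty β]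
    {S Z : Set α} (hS : IsPreconnected S) (hd : ∀ q, ∃ᶠ q' in 𝓝 q, q' ∉ Z) {k : α → β}
    (h : ∀ q ∈ S, ∃ g, ∀ᶠ q' in 𝓝 q, q' ∉ Z → k q' = g) :
    ∃ g, ∀ q ∈ S, ∀ᶠ q' in 𝓝 q, q' ∉ Z → k q' = g := by
  rcases S.eq_empty_or_nonempty with rfl | ⟨q₀, hq₀⟩
  · exact ⟨Classical.arbitrary β, fun q hq => hq.elim⟩
  classical
  let m : α → β := fun q => if hq : q ∈ S then (h q hq).choose else Classical.arbitrary β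
  have hm : ∀ q ∈ S, ∀ᶠ q' in 𝓝 q, q' ∉ Z → k q' = m q := by
    intro q hq
    simp only [m, dif_pos hq]
    exact (h q hq).choose_spec
  -- With the discrete topology on `β`, continuity of `m` means local constancy. For `q'` near `q`,
  -- a point off `Z` close to `q'` sees both `m q` and `m q'`, so they agree.
  let _ : TopologicalSpace β := ⊥
  have : DiscreteTopology β := ⟨rfl⟩
  have hc : ContinuousOn m S := by
    intro q hq
    have : ∀ᶠ q' in 𝓝[S] q, m q' = m q := by
      filter_upwards [nhdsWithin_le_nhds (eventually_eventually_nhds.2 (hm q hq)),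
        self_mem_nhdsWithin] with q' h1 h2
      obtain ⟨q'', h3, h4, h5⟩ := ((hd q').and_eventually (h1.and (hm q' h2))).exists
      exact (h5 h3).symm.trans (h4 h3)
    exact tendsto_nhds_of_eventually_eq this
  exact ⟨m q₀, fun q hq => by rw [hS.constant hc hq₀ hq]; exact hm q hq⟩

/-! ### Determinants and sides of lines in the plane. -/

/-- The determinant of two vectors of the plane. -/
def cross (u w : Plane) : ℝ := u.1 * w.2 - u.2 * w.1

theorem cross_self (u : Plane) : cross u u = 0 := by simp [cross, mul_comm]

theorem cross_swap (u w : Plane) : cross u w = -cross w u := by simp only [cross]; ring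

theorem cross_smul_right (u w : Plane) (k : ℝ) : cross u (k • w) = k * cross u w := by
  simp [cross]; ring

theorem cross_smul_left (u w : Plane) (k : ℝ) : cross (k • u) w = k * cross u w := by
  simp [cross]; ring

theorem cross_add_right (u w z : Plane) : cross u (w + z) = cross u w + cross u z := by
  simp [cross]; ring

theorem cross_sub_right (u w z : Plane) : cross u (w - z) = cross u w - cross u z := by
  simp [cross]; ring

theorem continuous_cross (u : Plane) : Continuous (cross u) := by unfold cross; fun_prop

theorem eq_smul_of_cross_eq_zero {u w : Plane} (hu : u ≠ 0) (h : cross u w = 0) :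
    ∃ k : ℝ, w = k • u := by
  simp only [cross] at h
  by_cases h1 : u.1 = 0
  · have h2 : u.2 ≠ 0 := fun h2 => hu (Prod.ext h1 h2)
    refine ⟨w.2 / u.2, Prod.ext ?_ ?_⟩
    · simp only [Prod.smul_fst, smul_eq_mul, h1, mul_zero]
      rw [h1, zero_mul, zero_sub, neg_eq_zero] at h
      exact (mul_eq_zero.1 h).resolve_left h2
    · simp [h2]
  · refine ⟨w.1 / u.1, Prod.ext ?_ ?_⟩
    · simp [h1]
    · simp only [Prod.smul_snd, smul_eq_mul]
      field_simp
      linarith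

theorem eventually_cross_pos {u p q : Plane} (h : 0 < cross u (q - p)) :
    ∀ᶠ q' in 𝓝 q, 0 < cross u (q' - p) := by
  have : Continuous fun q' => cross u (q' - p) := (continuous_cross u).comp (by fun_prop)
  exact this.continuousAt.eventually (lt_mem_nhds h)

theorem eventually_cross_neg {u p q : Plane} (h : cross u (q - p) < 0) :
    ∀ᶠ q' in 𝓝 q, cross u (q' - p) < 0 := by
  have : Continuous fun q' => cross u (q' - p) := (continuous_cross u).comp (by fun_prop)
  exact this.continuousAt.eventually (gt_mem_nhds h)

theorem tendsto_add_smul (p u : Plane) : Tendsto (fun δ : ℝ => p + δ • u) (𝓝[>] 0) (𝓝 p) := by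
  have : Continuous fun δ : ℝ => p + δ • u := by fun_prop
  simpa using (this.tendsto 0).mono_left nhdsWithin_le_nhds

theorem tendsto_sub_smul (p u : Plane) : Tendsto (fun δ : ℝ => p - δ • u) (𝓝[>] 0) (𝓝 p) := by
  have : Continuous fun δ : ℝ => p - δ • u := by fun_prop
  simpa using (this.tendsto 0).mono_left nhdsWithin_le_nhds

/-! ### The projection of a diagram: regular points, vertices and crossings. -/

namespace LinkDiagram

variable (D : LinkDiagram)

/-- The projection of the point at time `t` on the edge that starts at the vertex `v`. -/
def planePoint (v : Fin D.n) (t : ℝ) : Plane := (D.pos v).1 + t • D.dir v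

theorem edgePoint_fst (v : Fin D.n) (t : ℝ) : (D.edgePoint v t).1 = D.planePoint v t := by
  simp [PolygonalLink.edgePoint, PolygonalLink.dir, planePoint, AffineMap.lineMap_apply, add_comm]

theorem point_fst_eq (P : D.Param) : (D.point P).1 = D.planePoint P.1 P.2 := D.point_fst P

theorem planePoint_zero (v : Fin D.n) : D.planePoint v 0 = (D.pos v).1 := by simp [planePoint]

theorem planePoint_one (v : Fin D.n) : D.planePoint v 1 = (D.pos (D.next v)).1 := by
  rw [D.next_fst]; simp [planePoint]

theorem planePoint_eq_add (v : Fin D.n) (t s : ℝ) :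
    D.planePoint v s = D.planePoint v t + (s - t) • D.dir v := by
  simp only [planePoint]; module

theorem continuous_planePoint (v : Fin D.n) : Continuous (D.planePoint v) := by
  unfold planePoint; fun_prop

theorem edgePoint_one (v : Fin D.n) : D.edgePoint v 1 = D.edgePoint (D.next v) 0 := by
  simp [PolygonalLink.edgePoint]

theorem planePoint_injective (v : Fin D.n) : Function.Injective (D.planePoint v) := by
  intro t s h
  rw [D.planePoint_eq_add v t s] at h
  have := (smul_eq_zero.1 (left_eq_add.1 h)).resolve_right (D.dir_ne_zero v)
  linarith

theorem edgePoint_mem_carrier (v : Fin D.n) {t : ℝ} (ht : t ∈ Set.Icc (0 : ℝ) 1) :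
    D.edgePoint v t ∈ D.carrier := by
  rcases ht.2.lt_or_eq with h | rfl
  · exact ⟨(v, ⟨t, ht.1, h⟩), rfl⟩
  · exact ⟨(D.next v, ⟨0, le_rfl, one_pos⟩), (D.edgePoint_one v).symm⟩

theorem mem_shadow_iff {q : Plane} :
    q ∈ D.shadow ↔ ∃ v, ∃ t ∈ Set.Icc (0 : ℝ) 1, D.planePoint v t = q := by
  constructor
  · rintro ⟨_, ⟨P, rfl⟩, rfl⟩
    exact ⟨P.1, P.2, ⟨P.2.2.1, P.2.2.2.le⟩, (D.point_fst P).symm⟩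
  · rintro ⟨v, t, ht, rfl⟩
    exact ⟨_, D.edgePoint_mem_carrier v ht, D.edgePoint_fst v t⟩

theorem planePoint_mem_shadow (v : Fin D.n) {t : ℝ} (ht : t ∈ Set.Icc (0 : ℝ) 1) :
    D.planePoint v t ∈ D.shadow := D.mem_shadow_iff.2 ⟨v, t, ht, rfl⟩

/-- Near a point `p` there are only edges through `p`. -/
theorem eventually_through (p : Plane) : ∀ᶠ q in 𝓝 p, ∀ v, ∀ t ∈ Set.Icc (0 : ℝ) 1,
    D.planePoint v t = q → ∃ s ∈ Set.Icc (0 : ℝ) 1, D.planePoint v s = p := by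
  rw [eventually_all]
  intro v
  by_cases h : p ∈ D.planePoint v '' Set.Icc (0 : ℝ) 1
  · exact .of_forall fun _ _ _ _ => h
  · have hc : IsClosed (D.planePoint v '' Set.Icc (0 : ℝ) 1) :=
      (isCompact_Icc.image (D.continuous_planePoint v)).isClosed
    filter_upwards [hc.isOpen_compl.mem_nhds h] with q hq t ht e
    exact absurd ⟨t, ht, e⟩ hq

theorem eventually_notMem_shadow {p : Plane} (hp : p ∉ D.shadow) : ∀ᶠ q in 𝓝 p, q ∉ D.shadow := by
  filter_upwards [D.eventually_through p] with q hq h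
  obtain ⟨v, t, ht, e⟩ := D.mem_shadow_iff.1 h
  obtain ⟨s, hs, e'⟩ := hq v t ht e
  exact hp (e' ▸ D.planePoint_mem_shadow v hs)

/-- A ray that is not parallel to any edge through its end point leaves the shadow. -/
theorem eventually_ray {p u : Plane} (hu : ∀ v, ∀ s ∈ Set.Icc (0 : ℝ) 1, D.planePoint v s = p →
    cross (D.dir v) u ≠ 0) : ∀ᶠ δ : ℝ in 𝓝[>] 0, p + δ • u ∉ D.shadow := by
  filter_upwards [(tendsto_add_smul p u).eventually (D.eventually_through p),
    self_mem_nhdsWithin] with δ hδ h0 h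
  obtain ⟨v, t, ht, e⟩ := D.mem_shadow_iff.1 h
  obtain ⟨s, hs, e'⟩ := hδ v t ht e
  rw [D.planePoint_eq_add v s t, e'] at e
  have h1 : cross (D.dir v) ((t - s) • D.dir v) = cross (D.dir v) (δ • u) := by
    rw [add_left_cancel e]
  rw [cross_smul_right, cross_smul_right, cross_self, mul_zero] at h1
  rcases mul_eq_zero.1 h1.symm with h2 | h2
  · exact (ne_of_gt h0) h2
  · exact hu v s hs e' h2

/-- There are finitely many edges, so some slope `m` differs from all of theirs; a ray in the
direction `(1, m)` leaves the shadow at once. -/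
theorem frequently_notMem_shadow (p : Plane) : ∃ᶠ q in 𝓝 p, q ∉ D.shadow := by
  by_cases h : ∃ u : Plane, ∀ v, cross (D.dir v) u ≠ 0
  · obtain ⟨u, hu⟩ := h
    exact (tendsto_add_smul p u).frequently
      (D.eventually_ray fun v _ _ _ => hu v).frequently
  · obtain ⟨m, hm⟩ := ((Set.finite_range fun v => (D.dir v).2 / (D.dir v).1).infinite_compl
      (α := ℝ)).nonempty
    refine absurd ⟨(1, m), fun v h0 => ?_⟩ h
    simp only [cross, mul_one] at h0
    by_cases h1 : (D.dir v).1 = 0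
    · exact D.dir_ne_zero v (Prod.ext h1 (by simpa [h1] using h0))
    · exact hm ⟨v, by field_simp; linarith⟩

theorem cross_normal_pos (v : Fin D.n) : 0 < cross (D.dir v) (D.normal v) := by
  simp only [cross, PolygonalLink.normal]
  have := D.dir_ne_zero v
  by_contra h
  have h1 : (D.dir v).1 = 0 := by nlinarith [sq_nonneg (D.dir v).1, sq_nonneg (D.dir v).2]
  have h2 : (D.dir v).2 = 0 := by nlinarith [sq_nonneg (D.dir v).1, sq_nonneg (D.dir v).2]
  exact this (Prod.ext h1 h2)

/-- The interior point of an edge at time `t` is no crossing. -/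
def Regular (v : Fin D.n) (t : ℝ) : Prop :=
  0 < t ∧ t < 1 ∧ ∀ P : D.Param, (D.point P).1 = D.planePoint v t → P.1 = v ∧ (P.2 : ℝ) = t

variable {D}

theorem Regular.mem_Icc {v : Fin D.n} {t : ℝ} (h : D.Regular v t) : t ∈ Set.Icc (0 : ℝ) 1 :=
  ⟨h.1.le, h.2.1.le⟩

theorem Regular.through {v w : Fin D.n} {t s : ℝ} (h : D.Regular v t)
    (hs : s ∈ Set.Icc (0 : ℝ) 1) (e : D.planePoint w s = D.planePoint v t) : w = v ∧ s = t := by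
  rcases hs.2.lt_or_eq with h1 | rfl
  · exact h.2.2 (w, ⟨s, hs.1, h1⟩) (by rw [D.point_fst_eq, e])
  -- Time `1` is no parameter of the edge `w`: the end point is time `0` on the next edge, whereas a
  -- regular point has positive time.
  · have := h.2.2 (D.next w, ⟨0, le_rfl, one_pos⟩) (by
      rw [D.point_fst_eq, ← e, planePoint_one, planePoint_zero])
    exact absurd this.2 h.1.ne

variable (D)

theorem vertex_through {u w : Fin D.n} {s : ℝ} (hs : s ∈ Set.Icc (0 : ℝ) 1)
    (e : D.planePoint u s = (D.pos w).1) : (u = w ∧ s = 0) ∨ (D.next u = w ∧ s = 1) := by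
  rcases hs.2.lt_or_eq with h1 | rfl
  · have := D.vertex' w (u, ⟨s, hs.1, h1⟩) (by rw [D.point_fst_eq, e])
    exact .inl ⟨congrArg Prod.fst this, congrArg (fun z => (z.2 : ℝ)) this⟩
  · have := D.vertex' w (D.next u, ⟨0, le_rfl, one_pos⟩) (by
      rw [D.point_fst_eq, planePoint_zero, ← planePoint_one, e])
    exact .inr ⟨congrArg Prod.fst this, rfl⟩

variable {D}

/-- At time `0` the over point would be a vertex, and no other point of the link projects to the
same point as a vertex. -/
theorem Crossing.upper_pos (τ : D.Crossing) : 0 < (τ.upper.2 : ℝ) := by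
  refine τ.upper.2.2.1.lt_of_ne fun h => ?_
  have h1 : τ.upper = (τ.upper.1, ⟨0, le_rfl, one_pos⟩) := Prod.ext rfl (Subtype.ext h.symm)
  have h2 := D.vertex' τ.upper.1 τ.lower (by
    rw [← τ.proj_eq, D.point_fst_eq, ← h, planePoint_zero])
  exact (h1.trans h2.symm ▸ τ.lt).ne rfl

theorem Crossing.lower_pos (τ : D.Crossing) : 0 < (τ.lower.2 : ℝ) := by
  refine τ.lower.2.2.1.lt_of_ne fun h => ?_
  have h1 : τ.lower = (τ.lower.1, ⟨0, le_rfl, one_pos⟩) := Prod.ext rfl (Subtype.ext h.symm)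
  have h2 := D.vertex' τ.lower.1 τ.upper (by
    rw [τ.proj_eq, D.point_fst_eq, ← h, planePoint_zero])
  exact (h2.trans h1.symm ▸ τ.lt).ne rfl

theorem Crossing.center_eq_upper (τ : D.Crossing) :
    τ.center = D.planePoint τ.upper.1 τ.upper.2 := D.point_fst_eq _

theorem Crossing.center_eq_lower (τ : D.Crossing) :
    τ.center = D.planePoint τ.lower.1 τ.lower.2 := τ.proj_eq.trans (D.point_fst_eq _)

theorem Crossing.eq_or_eq (τ : D.Crossing) {P : D.Param} (h : (D.point P).1 = τ.center) :
    P = τ.upper ∨ P = τ.lower := by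
  rcases D.double' P τ.upper τ.lower h τ.proj_eq with e | e | e
  · exact .inl e
  · exact ((e ▸ τ.lt).ne rfl).elim
  · exact .inr e

theorem Crossing.center_ne_vertex (τ : D.Crossing) (v : Fin D.n) : τ.center ≠ (D.pos v).1 := by
  intro h
  have := D.vertex' v τ.upper h
  have h1 := τ.upper_pos
  rw [this] at h1
  exact lt_irrefl _ h1

theorem Crossing.through (τ : D.Crossing) {u : Fin D.n} {s : ℝ} (hs : s ∈ Set.Icc (0 : ℝ) 1)
    (e : D.planePoint u s = τ.center) :
    (u = τ.upper.1 ∧ s = τ.upper.2) ∨ (u = τ.lower.1 ∧ s = τ.lower.2) := by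
  rcases hs.2.lt_or_eq with h1 | rfl
  · rcases τ.eq_or_eq (P := (u, ⟨s, hs.1, h1⟩)) (by rw [D.point_fst_eq, e]) with h | h
    · exact .inl ⟨congrArg Prod.fst h, congrArg (fun z => (z.2 : ℝ)) h⟩
    · exact .inr ⟨congrArg Prod.fst h, congrArg (fun z => (z.2 : ℝ)) h⟩
  · exact (τ.center_ne_vertex _ (by rw [← e, planePoint_one])).elim

variable (D)

/-- A non-vertex fails to be regular only if a second point of the link has the same projection. The
link is embedded, so the heights differ and the two points form a crossing. -/
theorem shadow_cases {q : Plane} (hq : q ∈ D.shadow) :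
    (∃ v t, D.Regular v t ∧ D.planePoint v t = q) ∨ (∃ w, D.planePoint w 0 = q) ∨
      ∃ τ : D.Crossing, τ.center = q := by
  obtain ⟨_, ⟨P, rfl⟩, rfl⟩ := hq
  rcases P.2.2.1.eq_or_lt with h | h
  · exact .inr (.inl ⟨P.1, by rw [D.point_fst_eq, ← h]⟩)
  · by_cases hQ : ∃ Q : D.Param, (D.point Q).1 = (D.point P).1 ∧ Q ≠ P
    · obtain ⟨Q, h1, h2⟩ := hQ
      refine .inr (.inr ?_)
      have h3 : (D.point Q).2 ≠ (D.point P).2 := fun h3 =>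
        h2 (D.point_injective (Prod.ext h1 h3))
      rcases lt_or_gt_of_ne h3 with h4 | h4
      · exact ⟨⟨P, Q, h1.symm, h4⟩, rfl⟩
      · exact ⟨⟨Q, P, h1, h4⟩, h1⟩
    · refine .inl ⟨P.1, P.2, ⟨h, P.2.2.2, fun Q e => ?_⟩, (D.point_fst_eq P).symm⟩
      by_contra h1
      exact hQ ⟨Q, e.trans (D.point_fst_eq P).symm, fun h2 => h1 (by rw [h2]; exact ⟨rfl, rfl⟩)⟩

theorem finite_irregular :
    {q | q ∈ D.shadow ∧ ¬ ∃ v t, D.Regular v t ∧ D.planePoint v t = q}.Finite := by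
  refine ((Set.finite_range fun w => D.planePoint w 0).union
    (Set.finite_range fun τ : D.Crossing => τ.center)).subset ?_
  rintro q ⟨h1, h2⟩
  exact (D.shadow_cases h1).resolve_left h2

/-! ### Arcs along edges -/

variable {D}

theorem OnArc.unique {q : Space} {a b : D.Arc} (ha : D.OnArc q a) (hb : D.OnArc q b) : a = b := by
  obtain ⟨_, rfl⟩ := ha
  obtain ⟨_, rfl⟩ := hb
  rfl

variable (D)

theorem edgePoint_mem_underPoints {v : Fin D.n} {s : ℝ} (hs : s ∈ Set.Icc (0 : ℝ) 1)
    (h : D.edgePoint v s ∈ D.underPoints) :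
    ∃ τ : D.Crossing, τ.lower.1 = v ∧ (τ.lower.2 : ℝ) = s := by
  obtain ⟨τ, hτ⟩ := h
  rcases hs.2.lt_or_eq with h1 | rfl
  · have : τ.lower = (v, ⟨s, hs.1, h1⟩) := D.point_injective hτ
    exact ⟨τ, by rw [this], by rw [this]⟩
  · refine (τ.center_ne_vertex (D.next v) ?_).elim
    rw [Crossing.center, τ.proj_eq, hτ, edgePoint_fst, planePoint_one]

theorem Regular.notMem_underPoints {D : LinkDiagram} {v : Fin D.n} {t : ℝ} (h : D.Regular v t) :
    D.edgePoint v t ∉ D.underPoints := by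
  intro h1
  obtain ⟨τ, rfl, rfl⟩ := D.edgePoint_mem_underPoints h.mem_Icc h1
  exact Crossing.fst_ne D τ (h.2.2 τ.upper (by rw [τ.proj_eq, D.point_fst_eq])).1

/-- Arcs are connected components, and a segment free of under points has a connected image. -/
theorem onArc_of_segment {v : Fin D.n} {t₁ t₂ : ℝ} (h₁ : t₁ ∈ Set.Icc (0 : ℝ) 1)
    (h₂ : t₂ ∈ Set.Icc (0 : ℝ) 1)
    (h : ∀ s ∈ Set.uIcc t₁ t₂, D.edgePoint v s ∉ D.underPoints) {a : D.Arc}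
    (ha : D.OnArc (D.edgePoint v t₁) a) : D.OnArc (D.edgePoint v t₂) a := by
  have hm : ∀ s : Set.uIcc t₁ t₂, D.edgePoint v s ∈ D.carrier ∧ D.edgePoint v s ∉ D.underPoints :=
    fun s => ⟨D.edgePoint_mem_carrier v (Set.uIcc_subset_Icc h₁ h₂ s.2), h s s.2⟩
  have hcont : Continuous fun s : Set.uIcc t₁ t₂ =>
      (⟨D.edgePoint v s, hm s⟩ : {q : Space // q ∈ D.carrier ∧ q ∉ D.underPoints}) := by
    refine Continuous.subtype_mk ?_ _
    unfold PolygonalLink.edgePoint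
    exact AffineMap.lineMap_continuous.comp continuous_subtype_val
  have : PreconnectedSpace (Set.uIcc t₁ t₂) :=
    isPreconnected_iff_preconnectedSpace.1 Set.ordConnected_uIcc.isPreconnected
  have hr := isPreconnected_range hcont
  obtain ⟨h3, rfl⟩ := ha
  refine ⟨hm ⟨t₂, Set.right_mem_uIcc⟩, ConnectedComponents.coe_eq_coe'.2
    (hr.subset_connectedComponent ⟨⟨t₁, Set.left_mem_uIcc⟩, rfl⟩ ⟨⟨t₂, Set.right_mem_uIcc⟩, rfl⟩)⟩

theorem finite_underTimes (v : Fin D.n) :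
    {s | s ∈ Set.Icc (0 : ℝ) 1 ∧ D.edgePoint v s ∈ D.underPoints}.Finite := by
  refine (Set.finite_range fun τ : D.Crossing => (τ.lower.2 : ℝ)).subset ?_
  rintro s ⟨hs, h⟩
  obtain ⟨τ, -, h⟩ := D.edgePoint_mem_underPoints hs h
  exact ⟨τ, h⟩

theorem exists_ball_notMem_underPoints (v : Fin D.n) (t : ℝ) : ∃ ε > 0, ∀ s ∈ Set.Icc (0 : ℝ) 1,
    s ≠ t → |s - t| < ε → D.edgePoint v s ∉ D.underPoints := by
  have := ((D.finite_underTimes v).subset (Set.sdiff_subset (t := {t}))).isClosed.isOpen_compl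
  obtain ⟨ε, h0, h⟩ := Metric.isOpen_iff.1 this t (by simp)
  refine ⟨ε, h0, fun s hs hst hd hu => h (show s ∈ Metric.ball t ε from ?_) ⟨⟨hs, hu⟩, hst⟩⟩
  rwa [Metric.mem_ball, Real.dist_eq]

theorem eventually_onArc {v : Fin D.n} {t : ℝ} (ht : t ∈ Set.Icc (0 : ℝ) 1) {a : D.Arc}
    (ha : D.OnArc (D.edgePoint v t) a) :
    ∀ᶠ s in 𝓝 t, s ∈ Set.Icc (0 : ℝ) 1 → D.OnArc (D.edgePoint v s) a := by
  obtain ⟨ε, h0, h⟩ := D.exists_ball_notMem_underPoints v t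
  filter_upwards [Metric.ball_mem_nhds t h0] with s hs hs'
  refine D.onArc_of_segment ht hs' (fun r hr => ?_) ha
  by_cases hrt : r = t
  · rw [hrt]; exact ha.1.2
  · refine h r (Set.uIcc_subset_Icc ht hs' hr) hrt ?_
    rw [Metric.mem_ball, Real.dist_eq] at hs
    exact (Set.abs_sub_left_of_mem_uIcc hr).trans_lt hs

/-- Needed at under-crossing times `t`, where the point itself lies on no arc. Under-crossing times
are finite in number, so a short interval before `t` avoids them. -/
theorem exists_onArc_left {v : Fin D.n} {t : ℝ} (h0 : 0 < t) (h1 : t ≤ 1) :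
    ∃ a, ∀ᶠ s in 𝓝[<] t, D.OnArc (D.edgePoint v s) a := by
  obtain ⟨ε, hε, h⟩ := D.exists_ball_notMem_underPoints v t
  set m := max 0 (t - ε)
  have hm : m < t := max_lt h0 (by linarith)
  have hh : ∀ s ∈ Set.Ioo m t, s ∈ Set.Icc (0 : ℝ) 1 ∧ D.edgePoint v s ∉ D.underPoints := by
    intro s hs
    have h2 : 0 < s := (le_max_left _ _).trans_lt hs.1
    have h3 : t - ε < s := (le_max_right _ _).trans_lt hs.1
    have h4 : s ∈ Set.Icc (0 : ℝ) 1 := ⟨h2.le, hs.2.le.trans h1⟩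
    exact ⟨h4, h s h4 hs.2.ne (by rw [abs_sub_comm, abs_lt]; constructor <;> linarith [hs.2])⟩
  obtain ⟨s₀, hs₀⟩ := exists_between hm
  refine ⟨ConnectedComponents.mk ⟨D.edgePoint v s₀, D.edgePoint_mem_carrier v (hh s₀ hs₀).1,
    (hh s₀ hs₀).2⟩, ?_⟩
  filter_upwards [Ioo_mem_nhdsLT hm] with s hs
  exact D.onArc_of_segment (hh s₀ hs₀).1 (hh s hs).1
    (fun r hr => (hh r (Set.OrdConnected.uIcc_subset Set.ordConnected_Ioo hs₀ hs hr)).2) ⟨_, rfl⟩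

theorem exists_onArc_right {v : Fin D.n} {t : ℝ} (h0 : 0 ≤ t) (h1 : t < 1) :
    ∃ a, ∀ᶠ s in 𝓝[>] t, D.OnArc (D.edgePoint v s) a := by
  obtain ⟨ε, hε, h⟩ := D.exists_ball_notMem_underPoints v t
  set m := min 1 (t + ε)
  have hm : t < m := lt_min h1 (by linarith)
  have hh : ∀ s ∈ Set.Ioo t m, s ∈ Set.Icc (0 : ℝ) 1 ∧ D.edgePoint v s ∉ D.underPoints := by
    intro s hs
    have h2 : s < 1 := hs.2.trans_le (min_le_left _ _)
    have h3 : s < t + ε := hs.2.trans_le (min_le_right _ _)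
    have h4 : s ∈ Set.Icc (0 : ℝ) 1 := ⟨h0.trans hs.1.le, h2.le⟩
    exact ⟨h4, h s h4 hs.1.ne' (by rw [abs_lt]; constructor <;> linarith [hs.1])⟩
  obtain ⟨s₀, hs₀⟩ := exists_between hm
  refine ⟨ConnectedComponents.mk ⟨D.edgePoint v s₀, D.edgePoint_mem_carrier v (hh s₀ hs₀).1,
    (hh s₀ hs₀).2⟩, ?_⟩
  filter_upwards [Ioo_mem_nhdsGT hm] with s hs
  exact D.onArc_of_segment (hh s₀ hs₀).1 (hh s hs).1
    (fun r hr => (hh r (Set.OrdConnected.uIcc_subset Set.ordConnected_Ioo hs₀ hs hr)).2) ⟨_, rfl⟩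

end LinkDiagram

/-! ### One-sided neighbourhoods. -/

theorem eventually_cross_pos_sides {u p q : Plane} (n : Plane) (h : 0 < cross u (q - p)) :
    ∀ᶠ δ : ℝ in 𝓝[>] 0, 0 < cross u (q - δ • n - p) ∧ 0 < cross u (q + δ • n - p) :=
  ((tendsto_sub_smul q n).eventually (eventually_cross_pos h)).and
    ((tendsto_add_smul q n).eventually (eventually_cross_pos h))

theorem eventually_cross_neg_sides {u p q : Plane} (n : Plane) (h : cross u (q - p) < 0) :
    ∀ᶠ δ : ℝ in 𝓝[>] 0, cross u (q - δ • n - p) < 0 ∧ cross u (q + δ • n - p) < 0 :=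
  ((tendsto_sub_smul q n).eventually (eventually_cross_neg h)).and
    ((tendsto_add_smul q n).eventually (eventually_cross_neg h))

theorem eventually_cross_zero_sides {u p q n : Plane} (h : cross u (q - p) = 0)
    (hn : 0 < cross u n) :
    ∀ᶠ δ : ℝ in 𝓝[>] 0, cross u (q - δ • n - p) < 0 ∧ 0 < cross u (q + δ • n - p) := by
  filter_upwards [self_mem_nhdsWithin] with δ hδ
  have h0 : 0 < δ * cross u n := mul_pos hδ hn
  rw [sub_right_comm, add_sub_right_comm, cross_sub_right, cross_add_right, h, cross_smul_right]
  constructor <;> linarith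

/-- On the line `p + r • d` the distance to `p` is `|r| ‖d‖`, so a point close to `p` has a small
coefficient. -/
theorem eventually_small {d : Plane} (hd : d ≠ 0) (p : Plane) {P : ℝ → Prop}
    (h : ∀ᶠ r in 𝓝 0, P r) : ∀ᶠ q in 𝓝 p, ∀ r : ℝ, q - p = r • d → P r := by
  obtain ⟨ε, h0, h⟩ := Metric.eventually_nhds_iff.1 h
  have hd' : 0 < ‖d‖ := norm_pos_iff.2 hd
  filter_upwards [Metric.ball_mem_nhds p (mul_pos h0 hd')] with q hq r e
  rw [Metric.mem_ball, dist_eq_norm, e, norm_smul] at hq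
  refine h ?_
  rw [dist_zero_right]
  exact lt_of_mul_lt_mul_right hq hd'.le

/-- Treats both sides of `t` at once: since `σ² = 1`, the substitutions `s = t + σδ` and `δ = σ(s -
t)` are mutually inverse. -/
theorem eventually_right_iff {t σ : ℝ} (hσ : σ = 1 ∨ σ = -1) {P : ℝ → Prop} :
    (∀ᶠ δ in 𝓝[>] 0, P (t + σ * δ)) ↔ ∀ᶠ s in 𝓝 t, 0 < σ * (s - t) → P s := by
  have hs : σ * σ = 1 := by rcases hσ with rfl | rfl <;> norm_num
  rw [eventually_nhdsWithin_iff]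
  constructor
  · intro h
    have : Tendsto (fun s => σ * (s - t)) (𝓝 t) (𝓝 0) := by
      have hc : Continuous fun s => σ * (s - t) := by fun_prop
      simpa using hc.tendsto t
    filter_upwards [this.eventually h] with s h1 h2
    have := h1 h2
    rwa [← mul_assoc, hs, one_mul, add_sub_cancel] at this
  · intro h
    have : Tendsto (fun δ => t + σ * δ) (𝓝 0) (𝓝 t) := by
      have hc : Continuous fun δ => t + σ * δ := by fun_prop
      simpa using hc.tendsto 0
    filter_upwards [this.eventually h] with δ h1 h2
    refine h1 ?_
    rw [add_sub_cancel_left, ← mul_assoc, hs, one_mul]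
    exact h2

/-! ### Local solutions of the conditions on the region map. -/

namespace LinkDiagram

variable (D : LinkDiagram)

/-- An arc as an element of the associated group of the fundamental quandle. -/
def arcElt (a : D.Arc) : As D.FundamentalQuandle := As.of (D.arcGen a)

/-- At the point `p`, the function `c` satisfies the conditions on the map from the regions to the
associated group. -/
structure GoodAt (c : Plane → As D.FundamentalQuandle) (p : Plane) : Prop where
  locConst : p ∉ D.shadow → ∀ᶠ q in 𝓝 p, c q = c p
  jump : ∀ v t a, D.Regular v t → D.planePoint v t = p → D.OnArc (D.edgePoint v t) a →
    ∀ᶠ δ : ℝ in 𝓝[>] 0, c (p - δ • D.normal v) * D.arcElt a = c (p + δ • D.normal v)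

theorem eventually_param (v : Fin D.n) {s : ℝ} {P : ℝ → Prop} (h : ∀ᶠ t in 𝓝 s, P t) :
    ∀ᶠ q in 𝓝 (D.planePoint v s), ∀ t, D.planePoint v t = q → P t := by
  have h' : ∀ᶠ r in 𝓝 0, P (s + r) := by
    have : Tendsto (fun r => s + r) (𝓝 0) (𝓝 s) := by
      have hc : Continuous fun r => s + r := by fun_prop
      simpa using hc.tendsto 0
    exact this.eventually h
  filter_upwards [eventually_small (D.dir_ne_zero v) (D.planePoint v s) h'] with q hq t e
  have := hq (t - s) (by rw [← e, D.planePoint_eq_add v s t, add_sub_cancel_left])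
  rwa [add_sub_cancel] at this

/-- The predicate `P` selects the part of the line that the edge covers: everything at an interior
point of the edge, `r ≤ 0` or `0 ≤ r` at an end. -/
theorem eventually_mem_shadow_of_smul (v : Fin D.n) {s : ℝ} {P : ℝ → Prop}
    (h : ∀ᶠ r in 𝓝 0, P r → s + r ∈ Set.Icc (0 : ℝ) 1) :
    ∀ᶠ q in 𝓝 (D.planePoint v s), ∀ r : ℝ, q - D.planePoint v s = r • D.dir v → P r →
      q ∈ D.shadow := by
  filter_upwards [eventually_small (D.dir_ne_zero v) (D.planePoint v s) h] with q hq r e hr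
  rw [sub_eq_iff_eq_add'] at e
  rw [e, ← add_sub_cancel_left s r, ← D.planePoint_eq_add]
  exact D.planePoint_mem_shadow v (hq r (by rw [e, add_sub_cancel_left]) hr)

/-- Near `p` the shadow is a simple path, the projection of a part of the arc `a`, and `L` holds on
its left side. -/
def IsSideModel (p : Plane) (a : D.Arc) (L : Plane → Prop) : Prop :=
  ∀ᶠ q in 𝓝 p, (q ∉ D.shadow → ∀ᶠ q' in 𝓝 q, (L q' ↔ L q)) ∧
    ∀ u t b, D.Regular u t → D.planePoint u t = q → D.OnArc (D.edgePoint u t) b →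
      b = a ∧ ∀ᶠ δ : ℝ in 𝓝[>] 0, ¬ L (q - δ • D.normal u) ∧ L (q + δ • D.normal u)

open Classical in
/-- The function that is `1` on the right side and the generator on the left side. -/
def sideFun (a : D.Arc) (L : Plane → Prop) (q : Plane) : As D.FundamentalQuandle :=
  if L q then D.arcElt a else 1

theorem IsSideModel.goodAt {D : LinkDiagram} {p : Plane} {a : D.Arc} {L : Plane → Prop}
    (h : D.IsSideModel p a L) : ∀ᶠ q in 𝓝 p, D.GoodAt (D.sideFun a L) q := by
  filter_upwards [h] with q hq
  refine ⟨fun h1 => ?_, fun v t b h1 h2 h3 => ?_⟩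
  · filter_upwards [hq.1 h1] with q' h2
    by_cases h3 : L q <;> simp [sideFun, h2, h3]
  · obtain ⟨rfl, h4⟩ := hq.2 v t b h1 h2 h3
    filter_upwards [h4] with δ h5
    simp only [sideFun, h5.1, h5.2, if_true, if_false, one_mul]

/-- A straight piece of an arc. -/
theorem isSideModel_line {p d : Plane} {a : D.Arc}
    (h1 : ∀ᶠ q in 𝓝 p, cross d (q - p) = 0 → q ∈ D.shadow)
    (h2 : ∀ᶠ q in 𝓝 p, ∀ u t b, D.Regular u t → D.planePoint u t = q →
      D.OnArc (D.edgePoint u t) b → b = a ∧ cross d (q - p) = 0 ∧ 0 < cross d (D.normal u)) :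
    D.IsSideModel p a (fun q => 0 < cross d (q - p)) := by
  filter_upwards [h1, h2] with q h1 h2
  refine ⟨fun hq => ?_, fun u t b h3 h4 h5 => ?_⟩
  · rcases lt_trichotomy (cross d (q - p)) 0 with h | h | h
    · filter_upwards [eventually_cross_neg h] with q' h'
      exact iff_of_false h'.not_gt h.not_gt
    · exact absurd (h1 h) hq
    · filter_upwards [eventually_cross_pos h] with q' h'
      exact iff_of_true h' h
  · obtain ⟨h6, h7, h8⟩ := h2 u t b h3 h4 h5
    refine ⟨h6, ?_⟩
    filter_upwards [eventually_cross_zero_sides h7 h8] with δ h9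
    exact ⟨h9.1.not_gt, h9.2⟩

variable {D}

theorem Regular.eventually_mem_shadow_iff {v : Fin D.n} {t : ℝ} (h : D.Regular v t) :
    ∀ᶠ q in 𝓝 (D.planePoint v t),
      (q ∈ D.shadow ↔ cross (D.dir v) (q - D.planePoint v t) = 0) ∧
      ∀ u, ∀ s ∈ Set.Icc (0 : ℝ) 1, D.planePoint u s = q → u = v := by
  have hI : ∀ᶠ s in 𝓝 t, s ∈ Set.Icc (0 : ℝ) 1 := Icc_mem_nhds h.1 h.2.1
  have : ∀ᶠ r in 𝓝 0, True → t + r ∈ Set.Icc (0 : ℝ) 1 := by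
    have : Tendsto (fun r => t + r) (𝓝 0) (𝓝 t) := by
      have hc : Continuous fun r => t + r := by fun_prop
      simpa using hc.tendsto 0
    filter_upwards [this.eventually hI] with r hr _ using hr
  filter_upwards [D.eventually_mem_shadow_of_smul v this, D.eventually_through (D.planePoint v t)]
    with q hq h1
  have h2 : ∀ u, ∀ s ∈ Set.Icc (0 : ℝ) 1, D.planePoint u s = q → u = v := by
    intro u s hs e
    obtain ⟨r, hr, e'⟩ := h1 u s hs e
    exact (h.through hr e').1
  refine ⟨⟨fun hs => ?_, fun h0 => ?_⟩, h2⟩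
  · obtain ⟨u, s, hs, e⟩ := D.mem_shadow_iff.1 hs
    obtain rfl := h2 u s hs e
    rw [← e, D.planePoint_eq_add u t s, add_sub_cancel_left, cross_smul_right, cross_self,
      mul_zero]
  · obtain ⟨k, hk⟩ := eq_smul_of_cross_eq_zero (D.dir_ne_zero v) h0
    exact hq k hk trivial

variable (D)

theorem exists_isSideModel_regular {v : Fin D.n} {t : ℝ} (h : D.Regular v t) :
    ∃ a L, D.IsSideModel (D.planePoint v t) a L := by
  obtain ⟨a, hO⟩ : ∃ a, D.OnArc (D.edgePoint v t) a :=
    ⟨_, ⟨D.edgePoint_mem_carrier v h.mem_Icc, h.notMem_underPoints⟩, rfl⟩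
  have hA := D.eventually_onArc h.mem_Icc hO
  refine ⟨a, _, D.isSideModel_line (d := D.dir v) ?_ ?_⟩
  · filter_upwards [h.eventually_mem_shadow_iff] with q hq using hq.1.2
  · filter_upwards [h.eventually_mem_shadow_iff, D.eventually_param v hA]
      with q h1 h2 u s b h3 h4 h5
    obtain rfl := h1.2 u s h3.mem_Icc h4
    exact ⟨h5.unique (h2 s h4 h3.mem_Icc),
      h1.1.1 (h4 ▸ D.planePoint_mem_shadow u h3.mem_Icc), D.cross_normal_pos u⟩

theorem next_ne (v : Fin D.n) : D.next v ≠ v := by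
  intro h
  apply D.dir_ne_zero v
  simp [PolygonalLink.dir, h]

/-- Consecutive edges do not overlap. -/
theorem dir_next_ne (v : Fin D.n) {k : ℝ} (hk : 0 < k) : D.dir (D.next v) ≠ -(k • D.dir v) := by
  intro h
  have key : ∀ r : ℝ, D.planePoint (D.next v) r = D.planePoint v (1 - r * k) := by
    intro r
    rw [D.planePoint_eq_add v 1, D.planePoint_one, ← planePoint_zero, D.planePoint_eq_add _ 0 r, h]
    module
  have hk1 : 0 < 1 + k := by linarith
  -- Overlapping edges would meet at the times `r` and `r / 2` of the second one, against
  -- `meet_unique`. This `r` keeps both `r` and `r * k` between `0` and `1`.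
  set r := 1 / (1 + k) with hr
  have hr0 : 0 < r := by positivity
  have hr1 : r < 1 := by rw [hr, div_lt_one hk1]; linarith
  have hrk : r * k < 1 := by rw [hr, div_mul_eq_mul_div, one_mul, div_lt_one hk1]; linarith
  have hrk0 : 0 < r * k := by positivity
  have := (D.meet_unique (D.next v) v (D.next_ne v) ⟨r, hr0.le, hr1⟩
    ⟨r / 2, by positivity, by linarith⟩ ⟨1 - r * k, by linarith, by linarith⟩
    ⟨1 - r / 2 * k, by linarith, by linarith⟩
    (by simp only [D.point_fst_eq]; exact key _) (by simp only [D.point_fst_eq]; exact key _)).1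
  have := congrArg Subtype.val this
  simp only at this
  linarith

/-- Near a vertex only the incoming and the outgoing edge are present. They carry the same arc,
because a vertex is never an under-crossing point. -/
theorem vertex_local (v : Fin D.n) : ∃ a : D.Arc, ∀ᶠ q in 𝓝 (D.planePoint v 1),
    (∀ r : ℝ, q - D.planePoint v 1 = r • D.dir v → r ≤ 0 → q ∈ D.shadow) ∧
    (∀ r : ℝ, q - D.planePoint v 1 = r • D.dir (D.next v) → 0 ≤ r → q ∈ D.shadow) ∧
    ∀ u t b, D.Regular u t → D.planePoint u t = q → D.OnArc (D.edgePoint u t) b →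
      b = a ∧ ((∃ r : ℝ, r < 0 ∧ q - D.planePoint v 1 = r • D.dir v ∧ u = v) ∨
        ∃ r : ℝ, 0 < r ∧ q - D.planePoint v 1 = r • D.dir (D.next v) ∧ u = D.next v) := by
  have hp : D.planePoint v 1 = D.planePoint (D.next v) 0 := by
    rw [D.planePoint_one, D.planePoint_zero]
  have hu : D.edgePoint v 1 ∉ D.underPoints := by
    intro h
    obtain ⟨τ, -, h1⟩ := D.edgePoint_mem_underPoints (by simp) h
    exact absurd h1 τ.lower.2.2.2.ne
  obtain ⟨a, hO⟩ : ∃ a, D.OnArc (D.edgePoint v 1) a :=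
    ⟨_, ⟨D.edgePoint_mem_carrier v (by simp), hu⟩, rfl⟩
  refine ⟨a, ?_⟩
  have hA := D.eventually_onArc (by simp) hO
  have hB := D.eventually_onArc (v := D.next v) (t := 0) (by simp) (by
    rw [← D.edgePoint_one]; exact hO)
  have c1 : ∀ᶠ r : ℝ in 𝓝 0, r ≤ 0 → 1 + r ∈ Set.Icc (0 : ℝ) 1 := by
    filter_upwards [lt_mem_nhds (show (-1 : ℝ) < 0 by norm_num)] with r h1 h2
    exact ⟨by linarith, by linarith⟩
  have c2 : ∀ᶠ r : ℝ in 𝓝 0, 0 ≤ r → 0 + r ∈ Set.Icc (0 : ℝ) 1 := by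
    filter_upwards [gt_mem_nhds (show (0 : ℝ) < 1 by norm_num)] with r h1 h2
    exact ⟨by linarith, by linarith⟩
  have e2 := D.eventually_mem_shadow_of_smul (D.next v) c2
  have e4 := D.eventually_param (D.next v) hB
  rw [← hp] at e2 e4
  filter_upwards [D.eventually_mem_shadow_of_smul v c1, e2, D.eventually_param v hA, e4,
    D.eventually_through (D.planePoint v 1)] with q h1 h2 h3 h4 h5
  refine ⟨h1, h2, fun u t b h6 h7 h8 => ?_⟩
  obtain ⟨s, hs, e⟩ := h5 u t h6.mem_Icc h7
  rcases D.vertex_through hs (e.trans (D.planePoint_one v)) with ⟨rfl, rfl⟩ | ⟨hn, rfl⟩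
  · refine ⟨h8.unique (h4 t h7 h6.mem_Icc), .inr ⟨t, h6.1, ?_, rfl⟩⟩
    rw [hp, ← h7, D.planePoint_eq_add _ 0 t, add_sub_cancel_left, sub_zero]
  · obtain rfl := D.next.injective hn
    refine ⟨h8.unique (h3 t h7 h6.mem_Icc), .inl ⟨t - 1, by linarith [h6.2.1], ?_, rfl⟩⟩
    rw [← h7, D.planePoint_eq_add _ 1 t, add_sub_cancel_left]

/-- The left side of the bent path is the union of the left half planes of the two edges at a right
turn, their intersection at a left turn, and one half plane if the directions are parallel. -/
theorem exists_isSideModel_vertex (v : Fin D.n) : ∃ a L, D.IsSideModel (D.planePoint v 1) a L := by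
  obtain ⟨a, ha⟩ := D.vertex_local v
  refine ⟨a, ?_⟩
  set p := D.planePoint v 1
  set d₁ := D.dir v with hd₁
  set d₂ := D.dir (D.next v) with hd₂
  have n₁ : d₁ ≠ 0 := D.dir_ne_zero v
  have n₂ : d₂ ≠ 0 := D.dir_ne_zero _
  have hsw := cross_swap d₂ d₁
  rcases lt_trichotomy (cross d₁ d₂) 0 with hx | hx | hx
  · refine ⟨fun q => 0 < cross d₁ (q - p) ∨ 0 < cross d₂ (q - p), ?_⟩
    filter_upwards [ha] with q ⟨h1, h2, h3⟩
    refine ⟨fun hq => ?_, fun u t b h4 h5 h6 => ?_⟩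
    · by_cases p1 : 0 < cross d₁ (q - p)
      · filter_upwards [eventually_cross_pos p1] with q' h'
        exact iff_of_true (.inl h') (.inl p1)
      by_cases p2 : 0 < cross d₂ (q - p)
      · filter_upwards [eventually_cross_pos p2] with q' h'
        exact iff_of_true (.inr h') (.inr p2)
      -- On the line of the incoming edge, a point beyond the vertex is to the left of the outgoing
      -- edge, which `p2` excludes; the other points of the line lie on the edge itself, so in the
      -- shadow.
      have m1 : cross d₁ (q - p) < 0 := by
        refine (not_lt.1 p1).lt_of_ne fun h0 => ?_
        obtain ⟨k, hk⟩ := eq_smul_of_cross_eq_zero n₁ h0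
        refine hq (h1 k hk ?_)
        rw [hk, cross_smul_right] at p2
        by_contra hk0
        exact p2 (mul_pos (not_le.1 hk0) (by linarith))
      have m2 : cross d₂ (q - p) < 0 := by
        refine (not_lt.1 p2).lt_of_ne fun h0 => ?_
        obtain ⟨k, hk⟩ := eq_smul_of_cross_eq_zero n₂ h0
        refine hq (h2 k hk ?_)
        rw [hk, cross_smul_right] at p1
        by_contra hk0
        exact p1 (mul_pos_of_neg_of_neg (not_le.1 hk0) hx)
      filter_upwards [eventually_cross_neg m1, eventually_cross_neg m2] with q' h' h''
      exact iff_of_false (not_or.2 ⟨h'.not_gt, h''.not_gt⟩) (not_or.2 ⟨p1, p2⟩)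
    · obtain ⟨rfl, ⟨r, hr, e, rfl⟩ | ⟨r, hr, e, rfl⟩⟩ := h3 u t b h4 h5 h6
      · refine ⟨rfl, ?_⟩
        have z1 : cross d₁ (q - p) = 0 := by rw [e, cross_smul_right, cross_self, mul_zero]
        have z2 : cross d₂ (q - p) < 0 := by
          rw [e, cross_smul_right]; exact mul_neg_of_neg_of_pos hr (by linarith)
        filter_upwards [eventually_cross_zero_sides z1 (D.cross_normal_pos u),
          eventually_cross_neg_sides (D.normal u) z2] with δ h7 h8
        exact ⟨not_or.2 ⟨h7.1.not_gt, h8.1.not_gt⟩, .inl h7.2⟩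
      · refine ⟨rfl, ?_⟩
        have z1 : cross d₂ (q - p) = 0 := by rw [e, cross_smul_right, cross_self, mul_zero]
        have z2 : cross d₁ (q - p) < 0 := by
          rw [e, cross_smul_right]; exact mul_neg_of_pos_of_neg hr hx
        filter_upwards [eventually_cross_zero_sides z1 (D.cross_normal_pos (D.next v)),
          eventually_cross_neg_sides (D.normal (D.next v)) z2] with δ h7 h8
        exact ⟨not_or.2 ⟨h8.1.not_gt, h7.1.not_gt⟩, .inr h7.2⟩
  · obtain ⟨k, hk⟩ := eq_smul_of_cross_eq_zero n₁ hx
    -- Parallel consecutive edges continue straight on: a negative `k` would make them overlap.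
    have hk0 : 0 < k := by
      rcases lt_trichotomy k 0 with h | h | h
      · refine (D.dir_next_ne v (neg_pos.2 h) ?_).elim
        rw [neg_smul, neg_neg]; exact hk
      · rw [h, zero_smul] at hk; exact (n₂ hk).elim
      · exact h
    refine ⟨_, D.isSideModel_line (d := d₁) ?_ ?_⟩
    · filter_upwards [ha] with q ⟨h1, h2, _⟩ h0
      obtain ⟨m, hm⟩ := eq_smul_of_cross_eq_zero n₁ h0
      rcases le_total m 0 with h | h
      · exact h1 m hm h
      · refine h2 (m / k) ?_ (div_nonneg h hk0.le)
        rw [hk, smul_smul, div_mul_cancel₀ _ hk0.ne']; exact hm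
    · filter_upwards [ha] with q ⟨_, _, h3⟩ u t b h4 h5 h6
      obtain ⟨rfl, ⟨r, hr, e, rfl⟩ | ⟨r, hr, e, rfl⟩⟩ := h3 u t b h4 h5 h6
      · exact ⟨rfl, by rw [e, cross_smul_right, cross_self, mul_zero], D.cross_normal_pos u⟩
      · refine ⟨rfl, by rw [e, cross_smul_right, hx, mul_zero], ?_⟩
        have := D.cross_normal_pos (D.next v)
        rw [← hd₂, hk, cross_smul_left] at this
        exact pos_of_mul_pos_right this hk0.le
  · refine ⟨fun q => 0 < cross d₁ (q - p) ∧ 0 < cross d₂ (q - p), ?_⟩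
    filter_upwards [ha] with q ⟨h1, h2, h3⟩
    refine ⟨fun hq => ?_, fun u t b h4 h5 h6 => ?_⟩
    · by_cases p1 : cross d₁ (q - p) < 0
      · filter_upwards [eventually_cross_neg p1] with q' h'
        exact iff_of_false (fun h => h.1.not_gt h') (fun h => h.1.not_gt p1)
      by_cases p2 : cross d₂ (q - p) < 0
      · filter_upwards [eventually_cross_neg p2] with q' h'
        exact iff_of_false (fun h => h.2.not_gt h') (fun h => h.2.not_gt p2)
      have m1 : 0 < cross d₁ (q - p) := by
        refine (not_lt.1 p1).lt_of_ne fun h0 => ?_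
        obtain ⟨k, hk⟩ := eq_smul_of_cross_eq_zero n₁ h0.symm
        refine hq (h1 k hk ?_)
        rw [hk, cross_smul_right] at p2
        by_contra hk0
        exact p2 (mul_neg_of_pos_of_neg (not_le.1 hk0) (by linarith))
      have m2 : 0 < cross d₂ (q - p) := by
        refine (not_lt.1 p2).lt_of_ne fun h0 => ?_
        obtain ⟨k, hk⟩ := eq_smul_of_cross_eq_zero n₂ h0.symm
        refine hq (h2 k hk ?_)
        rw [hk, cross_smul_right] at p1
        by_contra hk0
        exact p1 (mul_neg_of_neg_of_pos (not_le.1 hk0) hx)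
      filter_upwards [eventually_cross_pos m1, eventually_cross_pos m2] with q' h' h''
      exact iff_of_true ⟨h', h''⟩ ⟨m1, m2⟩
    · obtain ⟨rfl, ⟨r, hr, e, rfl⟩ | ⟨r, hr, e, rfl⟩⟩ := h3 u t b h4 h5 h6
      · refine ⟨rfl, ?_⟩
        have z1 : cross d₁ (q - p) = 0 := by rw [e, cross_smul_right, cross_self, mul_zero]
        have z2 : 0 < cross d₂ (q - p) := by
          rw [e, cross_smul_right]; exact mul_pos_of_neg_of_neg hr (by linarith)
        filter_upwards [eventually_cross_zero_sides z1 (D.cross_normal_pos u),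
          eventually_cross_pos_sides (D.normal u) z2] with δ h7 h8
        exact ⟨fun h => h.1.not_gt h7.1, h7.2, h8.2⟩
      · refine ⟨rfl, ?_⟩
        have z1 : cross d₂ (q - p) = 0 := by rw [e, cross_smul_right, cross_self, mul_zero]
        have z2 : 0 < cross d₁ (q - p) := by
          rw [e, cross_smul_right]; exact mul_pos hr hx
        filter_upwards [eventually_cross_zero_sides z1 (D.cross_normal_pos (D.next v)),
          eventually_cross_pos_sides (D.normal (D.next v)) z2] with δ h7 h8
        exact ⟨fun h => h.2.not_gt h7.1, h8.2, h7.2⟩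


variable {D : LinkDiagram}

namespace Crossing

variable (τ : D.Crossing)

/-- The two strands of a crossing are transverse. -/
theorem cross_ne_zero : cross τ.overDir τ.underDir ≠ 0 := by
  intro h
  obtain ⟨k, hk⟩ := eq_smul_of_cross_eq_zero (D.dir_ne_zero _) h
  have hc : τ.center = D.planePoint τ.upper.1 τ.upper.2 := τ.center_eq_upper
  have hc' : τ.center = D.planePoint τ.lower.1 τ.lower.2 := τ.center_eq_lower
  have e1 : Tendsto (fun r : ℝ => (τ.lower.2 : ℝ) + r) (𝓝[>] 0) (𝓝 τ.lower.2) := by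
    have : Continuous fun r : ℝ => (τ.lower.2 : ℝ) + r := by fun_prop
    simpa using (this.tendsto 0).mono_left nhdsWithin_le_nhds
  have e2 : Tendsto (fun r : ℝ => (τ.upper.2 : ℝ) + r * k) (𝓝[>] 0) (𝓝 τ.upper.2) := by
    have : Continuous fun r : ℝ => (τ.upper.2 : ℝ) + r * k := by fun_prop
    simpa using (this.tendsto 0).mono_left nhdsWithin_le_nhds
  -- If the strands were parallel, moving both by the same small vector would give a second common
  -- point of the two edges.
  obtain ⟨r, h1, h2, hr⟩ := ((e1.eventually (Ico_mem_nhds τ.lower_pos τ.lower.2.2.2)).and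
    ((e2.eventually (Ico_mem_nhds τ.upper_pos τ.upper.2.2.2)).and self_mem_nhdsWithin)).exists
  have := (D.meet_unique _ _ (Crossing.fst_ne D τ).symm τ.lower.2 ⟨_, h1⟩ τ.upper.2 ⟨_, h2⟩ τ.proj_eq.symm (by
    simp only [D.point_fst_eq]
    rw [D.planePoint_eq_add τ.lower.1 τ.lower.2, D.planePoint_eq_add τ.upper.1 τ.upper.2, ← hc,
      ← hc']
    change τ.center + _ • τ.underDir = τ.center + _ • τ.overDir
    rw [hk, smul_smul, add_sub_cancel_left, add_sub_cancel_left]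
    rfl)).1
  have := congrArg Subtype.val this
  simp only at this
  exact (ne_of_gt hr) (by linarith)

theorem sign_of_pos (h : 0 < cross τ.overDir τ.underDir) : τ.sign = 1 := if_pos h

theorem sign_of_neg (h : cross τ.overDir τ.underDir < 0) : τ.sign = -1 := if_neg h.not_gt

theorem sign_cases : (τ.sign : ℝ) = 1 ∨ (τ.sign : ℝ) = -1 := by
  rcases τ.cross_ne_zero.lt_or_gt with h | h
  · right; rw [τ.sign_of_neg h]; norm_num
  · left; rw [τ.sign_of_pos h]; norm_num

theorem sign_mul_cross_pos : 0 < (τ.sign : ℝ) * cross τ.overDir τ.underDir := by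
  rcases τ.cross_ne_zero.lt_or_gt with h | h
  · rw [τ.sign_of_neg h]; push_cast; linarith
  · rw [τ.sign_of_pos h]; push_cast; linarith

theorem exists_onArc_side {σ : ℝ} (hσ : σ = 1 ∨ σ = -1) : ∃ a, ∀ᶠ δ : ℝ in 𝓝[>] 0,
    D.OnArc (D.edgePoint τ.lower.1 (τ.lower.2 + σ * δ)) a := by
  rcases hσ with h | h
  · obtain ⟨a, ha⟩ := D.exists_onArc_right (v := τ.lower.1) τ.lower_pos.le τ.lower.2.2.2
    refine ⟨a, (eventually_right_iff (P := fun s => D.OnArc (D.edgePoint τ.lower.1 s) a)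
      (.inl h)).2 ?_⟩
    rw [eventually_nhdsWithin_iff] at ha
    filter_upwards [ha] with s h1 h2
    refine h1 ?_
    rw [h, one_mul, sub_pos] at h2
    exact h2
  · obtain ⟨a, ha⟩ := D.exists_onArc_left (v := τ.lower.1) τ.lower_pos τ.lower.2.2.2.le
    refine ⟨a, (eventually_right_iff (P := fun s => D.OnArc (D.edgePoint τ.lower.1 s) a)
      (.inr h)).2 ?_⟩
    rw [eventually_nhdsWithin_iff] at ha
    filter_upwards [ha] with s h1 h2
    refine h1 ?_
    rw [h, neg_one_mul, neg_sub, sub_pos] at h2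
    exact h2

theorem exists_isTargetArc : ∃ a, τ.IsTargetArc a := τ.exists_onArc_side τ.sign_cases

theorem isSourceArc_sourceArc : τ.IsSourceArc τ.sourceArc := by
  obtain ⟨a, ha⟩ := τ.exists_onArc_side (σ := -τ.sign) (by
    rcases τ.sign_cases with h | h <;> simp [h])
  refine Classical.epsilon_spec (p := τ.IsSourceArc) ⟨a, ?_⟩
  filter_upwards [ha] with δ h
  rwa [neg_mul, ← sub_eq_add_neg] at h

/-- The crossing relation, read in the associated group: the two ways around the crossing, from the
region right of both strands to the opposite one, give the same product. -/
theorem arcElt_mul {a c : D.Arc} (ha : τ.IsSourceArc a) (hc : τ.IsTargetArc c) :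
    D.arcElt a * D.arcElt τ.overArc = D.arcElt τ.overArc * D.arcElt c := by
  have h : qop (D.arcGen a) (D.arcGen τ.overArc) = D.arcGen c :=
    Quotient.sound (s := QWord.setoid D.crossingRel) (QWord.Rel.rel ⟨τ, ha, rfl, hc⟩)
  rw [arcElt, arcElt, arcElt, ← h, As.of_qop]
  group

/-- Regular points near a crossing lie on one of its two strands, away from the centre. The sign of
`sign * r` separates the two under arcs, since the under strand runs along the normal of the over
strand exactly at positive crossings. -/
theorem local_structure {a c : D.Arc} (ha : τ.IsSourceArc a) (hc : τ.IsTargetArc c) :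
    ∀ᶠ q in 𝓝 τ.center, (cross τ.overDir (q - τ.center) = 0 → q ∈ D.shadow) ∧
      (cross τ.underDir (q - τ.center) = 0 → q ∈ D.shadow) ∧
      ∀ u t b, D.Regular u t → D.planePoint u t = q → D.OnArc (D.edgePoint u t) b →
        (u = τ.upper.1 ∧ b = τ.overArc ∧ ∃ r : ℝ, r ≠ 0 ∧ q - τ.center = r • τ.overDir) ∨
        (u = τ.lower.1 ∧ ∃ r : ℝ, r ≠ 0 ∧ q - τ.center = r • τ.underDir ∧
          ((τ.sign * r < 0 ∧ b = a) ∨ (0 < τ.sign * r ∧ b = c))) := by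
  have key : ∀ P : D.Param, 0 < (P.2 : ℝ) → (D.point P).1 = τ.center → ∀ᶠ q in 𝓝 τ.center,
      cross (D.dir P.1) (q - τ.center) = 0 → q ∈ D.shadow := by
    intro P h0 hP
    have e : ∀ᶠ r : ℝ in 𝓝 0, True → (P.2 : ℝ) + r ∈ Set.Icc (0 : ℝ) 1 := by
      have : Tendsto (fun r => (P.2 : ℝ) + r) (𝓝 0) (𝓝 P.2) := by
        have hc : Continuous fun r => (P.2 : ℝ) + r := by fun_prop
        simpa using hc.tendsto 0
      filter_upwards [this.eventually (Icc_mem_nhds h0 P.2.2.2)] with r hr _ using hr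
    have := D.eventually_mem_shadow_of_smul P.1 e
    rw [← D.point_fst_eq, hP] at this
    filter_upwards [this] with q hq h0
    obtain ⟨k, hk⟩ := eq_smul_of_cross_eq_zero (D.dir_ne_zero P.1) h0
    exact hq k hk trivial
  have hs : ∀ᶠ s in 𝓝 (τ.lower.2 : ℝ), 0 < -(τ.sign : ℝ) * (s - τ.lower.2) →
      D.OnArc (D.edgePoint τ.lower.1 s) a := by
    refine (eventually_right_iff ?_).1 ?_
    · rcases τ.sign_cases with h | h <;> simp [h]
    · filter_upwards [ha] with δ h
      rwa [neg_mul, ← sub_eq_add_neg]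
  have ht := (eventually_right_iff (P := fun s => D.OnArc (D.edgePoint τ.lower.1 s) c)
    τ.sign_cases).1 hc
  have ho := D.eventually_onArc (v := τ.upper.1) (t := τ.upper.2) ⟨τ.upper_pos.le, τ.upper.2.2.2.le⟩
    (a := τ.overArc) ⟨_, rfl⟩
  have eo := D.eventually_param τ.upper.1 ho
  have eu := D.eventually_param τ.lower.1 (hs.and ht)
  rw [← τ.center_eq_upper] at eo
  rw [← τ.center_eq_lower] at eu
  filter_upwards [key τ.upper τ.upper_pos rfl, key τ.lower τ.lower_pos τ.proj_eq.symm, eo, eu,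
    D.eventually_through τ.center] with q h1 h2 h3 h4 h5
  refine ⟨h1, h2, fun u t b h6 h7 h8 => ?_⟩
  have hqc : q ≠ τ.center := by
    intro e
    have r1 := h6.2.2 τ.upper (by rw [h7, e]; rfl)
    have r2 := h6.2.2 τ.lower (by rw [h7, e]; exact τ.proj_eq.symm)
    exact Crossing.fst_ne D τ (r1.1.trans r2.1.symm)
  obtain ⟨s, hs, e⟩ := h5 u t h6.mem_Icc h7
  have hq : q - τ.center = (t - s) • D.dir u := by
    rw [← h7, ← e, D.planePoint_eq_add u s t, add_sub_cancel_left]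
  have hr : t - s ≠ 0 := by
    intro h0
    rw [h0, zero_smul, sub_eq_zero] at hq
    exact hqc hq
  rcases τ.through hs e with ⟨rfl, rfl⟩ | ⟨rfl, rfl⟩
  · exact .inl ⟨rfl, h8.unique (h3 t h7 h6.mem_Icc), _, hr, hq⟩
  · refine .inr ⟨rfl, _, hr, hq, ?_⟩
    obtain ⟨h9, h10⟩ := h4 t h7
    rcases lt_trichotomy ((τ.sign : ℝ) * (t - τ.lower.2)) 0 with h | h | h
    · exact .inl ⟨h, h8.unique (h9 (by linarith))⟩
    · rcases mul_eq_zero.1 h with h | h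
      · rcases τ.sign_cases with h' | h' <;> rw [h'] at h <;> norm_num at h
      · exact (hr h).elim
    · exact .inr ⟨h, h8.unique (h10 h)⟩

open Classical in
/-- The function with the value `1` on the region on the right side of both strands of a crossing;
`a` and `c` are the under arcs. -/
def sectorFun (a c : D.Arc) (q : Plane) : As D.FundamentalQuandle :=
  if 0 < cross τ.overDir (q - τ.center) then
    D.arcElt τ.overArc * if 0 < cross τ.underDir (q - τ.center) then D.arcElt c else 1
  else if 0 < cross τ.underDir (q - τ.center) then D.arcElt a else 1

/-- The four sectors have the values `1`, `a`, `b` and `bc`, with `b` the over arc. Three of the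
four jumps hold by construction; the fourth, over the over strand on the left of the under strand,
is `ab = bc`. -/
theorem goodAt_sectorFun {a c : D.Arc} (ha : τ.IsSourceArc a) (hc : τ.IsTargetArc c) :
    ∀ᶠ q in 𝓝 τ.center, D.GoodAt (τ.sectorFun a c) q := by
  have hx := τ.sign_mul_cross_pos
  have hsw := cross_swap τ.underDir τ.overDir
  filter_upwards [τ.local_structure ha hc] with q ⟨h1, h2, h3⟩
  refine ⟨fun hq => ?_, fun u t b h4 h5 h6 => ?_⟩
  · have z1 : cross τ.overDir (q - τ.center) ≠ 0 := fun h => hq (h1 h)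
    have z2 : cross τ.underDir (q - τ.center) ≠ 0 := fun h => hq (h2 h)
    rcases z1.lt_or_gt with z1 | z1 <;> rcases z2.lt_or_gt with z2 | z2
    · filter_upwards [eventually_cross_neg z1, eventually_cross_neg z2] with q' w1 w2
      simp only [sectorFun, z1.not_gt, z2.not_gt, w1.not_gt, w2.not_gt]
    · filter_upwards [eventually_cross_neg z1, eventually_cross_pos z2] with q' w1 w2
      simp only [sectorFun, z1.not_gt, z2, w1.not_gt, w2]
    · filter_upwards [eventually_cross_pos z1, eventually_cross_neg z2] with q' w1 w2
      simp only [sectorFun, z1, z2.not_gt, w1, w2.not_gt]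
    · filter_upwards [eventually_cross_pos z1, eventually_cross_pos z2] with q' w1 w2
      simp only [sectorFun, z1, z2, w1, w2]
  · rcases h3 u t b h4 h5 h6 with ⟨rfl, rfl, r, hr, e⟩ | ⟨rfl, r, hr, e, hb⟩
    · have z1 : cross τ.overDir (q - τ.center) = 0 := by
        rw [e, cross_smul_right, cross_self, mul_zero]
      have z2 : cross τ.underDir (q - τ.center) ≠ 0 := by
        rw [e, cross_smul_right, hsw]
        exact mul_ne_zero hr (neg_ne_zero.2 τ.cross_ne_zero)
      rcases z2.lt_or_gt with z2 | z2
      · filter_upwards [eventually_cross_zero_sides z1 (D.cross_normal_pos _),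
          eventually_cross_neg_sides (D.normal τ.upper.1) z2] with δ w1 w2
        simp only [sectorFun, w1.1.not_gt, w1.2, w2.1.not_gt, w2.2.not_gt, if_true, if_false,
          one_mul, mul_one]
      · filter_upwards [eventually_cross_zero_sides z1 (D.cross_normal_pos _),
          eventually_cross_pos_sides (D.normal τ.upper.1) z2] with δ w1 w2
        simp only [sectorFun, w1.1.not_gt, w1.2, w2.1, w2.2, if_true, if_false]
        exact τ.arcElt_mul ha hc
    · have z2 : cross τ.underDir (q - τ.center) = 0 := by
        rw [e, cross_smul_right, cross_self, mul_zero]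
      have z1 : cross τ.overDir (q - τ.center) = r * cross τ.overDir τ.underDir := by
        rw [e, cross_smul_right]
      have hsq : (τ.sign : ℝ) * τ.sign = 1 := by
        rcases τ.sign_cases with h | h <;> rw [h] <;> norm_num
      have z3 : cross τ.overDir (q - τ.center) =
          (τ.sign * r) * (τ.sign * cross τ.overDir τ.underDir) := by
        rw [z1]; linear_combination (-(r * cross τ.overDir τ.underDir)) * hsq
      rcases hb with ⟨hb, rfl⟩ | ⟨hb, rfl⟩
      · have z1 : cross τ.overDir (q - τ.center) < 0 := by
          rw [z3]; exact mul_neg_of_neg_of_pos hb hx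
        filter_upwards [eventually_cross_zero_sides z2 (D.cross_normal_pos _),
          eventually_cross_neg_sides (D.normal τ.lower.1) z1] with δ w1 w2
        simp only [sectorFun, w1.1.not_gt, w1.2, w2.1.not_gt, w2.2.not_gt, if_true, if_false,
          one_mul]
      · have z1 : 0 < cross τ.overDir (q - τ.center) := by
          rw [z3]; exact mul_pos hb hx
        filter_upwards [eventually_cross_zero_sides z2 (D.cross_normal_pos _),
          eventually_cross_pos_sides (D.normal τ.lower.1) z1] with δ w1 w2
        simp only [sectorFun, w1.1.not_gt, w1.2, w2.1, w2.2, if_true, if_false, mul_one]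

end Crossing

variable (D)

/-- Near each point there is a solution of the conditions on the region map. -/
theorem exists_goodAt (p : Plane) : ∃ c, ∀ᶠ q in 𝓝 p, D.GoodAt c q := by
  by_cases hp : p ∈ D.shadow
  · rcases D.shadow_cases hp with ⟨v, t, h, rfl⟩ | ⟨w, rfl⟩ | ⟨τ, rfl⟩
    · obtain ⟨a, L, hL⟩ := D.exists_isSideModel_regular h
      exact ⟨_, hL.goodAt⟩
    · obtain ⟨v, rfl⟩ := D.next.surjective w
      obtain ⟨a, L, hL⟩ := D.exists_isSideModel_vertex v
      rw [D.planePoint_one, ← D.planePoint_zero] at hL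
      exact ⟨_, hL.goodAt⟩
    · obtain ⟨c, hc⟩ := τ.exists_isTargetArc
      exact ⟨_, τ.goodAt_sectorFun τ.isSourceArc_sourceArc hc⟩
  · refine ⟨fun _ => 1, ?_⟩
    filter_upwards [D.eventually_notMem_shadow hp] with q hq
    refine ⟨fun _ => .of_forall fun _ => rfl, fun v t a h1 h2 _ => ?_⟩
    exact (hq (h2 ▸ D.planePoint_mem_shadow v h1.mem_Icc)).elim

end LinkDiagram

/-! ### Gluing local solutions; existence of the region map. -/

theorem isPreconnected_ball_diff_center (p : Plane) (ε : ℝ) :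
    IsPreconnected (Metric.ball p ε \ {p}) := by
  rcases le_or_gt ε 0 with h | hε
  · rw [Metric.ball_eq_empty.2 h, Set.empty_sdiff]
    exact isPreconnected_empty
  have hr : 1 < Module.rank ℝ Plane := Module.one_lt_rank_of_one_lt_finrank (by simp)
  have h0 := (isConnected_compl_singleton_of_one_lt_rank hr (0 : Plane)).isPreconnected
  -- This radial contraction carries the punctured plane onto the punctured ball; its inverse sends
  -- `q` to `(q - p) / (ε - ‖q - p‖)`.
  have hc : Continuous fun y : Plane => p + (ε / (1 + ‖y‖)) • y := by
    have : ∀ y : Plane, 1 + ‖y‖ ≠ 0 := fun y => by positivity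
    fun_prop (disch := assumption)
  convert h0.image _ hc.continuousOn using 1
  ext q
  simp only [Set.mem_sdiff, Metric.mem_ball, dist_eq_norm, Set.mem_singleton_iff, Set.mem_image,
    Set.mem_compl_iff]
  constructor
  · rintro ⟨h1, h2⟩
    have h3 : 0 < ε - ‖q - p‖ := sub_pos.2 h1
    refine ⟨(ε - ‖q - p‖)⁻¹ • (q - p), ?_, ?_⟩
    · exact smul_ne_zero (inv_ne_zero h3.ne') (sub_ne_zero.2 h2)
    · rw [norm_smul, Real.norm_eq_abs, abs_of_pos (inv_pos.2 h3), smul_smul]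
      have : ε / (1 + (ε - ‖q - p‖)⁻¹ * ‖q - p‖) * (ε - ‖q - p‖)⁻¹ = 1 := by
        field_simp
        ring
      rw [this, one_smul, add_sub_cancel]
  · rintro ⟨y, hy, rfl⟩
    have h3 : 0 < 1 + ‖y‖ := by positivity
    refine ⟨?_, ?_⟩
    · rw [add_sub_cancel_left, norm_smul, Real.norm_eq_abs, abs_of_pos (by positivity),
        div_mul_eq_mul_div, div_lt_iff₀ h3]
      nlinarith [norm_nonneg y]
    · rw [add_eq_left]
      exact smul_ne_zero (by positivity) hy

/-- The punctured plane is pushed outwards radially by the distance `M`. -/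
theorem isPreconnected_lt_norm {M : ℝ} (hM : 0 < M) : IsPreconnected {q : Plane | M < ‖q‖} := by
  have hr : 1 < Module.rank ℝ Plane := Module.one_lt_rank_of_one_lt_finrank (by simp)
  have h0 := (isConnected_compl_singleton_of_one_lt_rank hr (0 : Plane)).isPreconnected
  have hc : ContinuousOn (fun y : Plane => (1 + M / ‖y‖) • y) {0}ᶜ := by
    have : ∀ y ∈ ({0}ᶜ : Set Plane), ‖y‖ ≠ 0 := fun y hy => norm_ne_zero_iff.2 hy
    fun_prop (disch := assumption)
  convert h0.image _ hc using 1
  ext q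
  simp only [Set.mem_ofPred_eq, Set.mem_image, Set.mem_compl_iff, Set.mem_singleton_iff]
  constructor
  · intro hq
    have h1 : 0 < ‖q‖ := hM.trans hq
    have h2 : 0 < ‖q‖ - M := sub_pos.2 hq
    refine ⟨((‖q‖ - M) / ‖q‖) • q, smul_ne_zero (div_pos h2 h1).ne' (norm_pos_iff.1 h1), ?_⟩
    rw [norm_smul, Real.norm_eq_abs, abs_of_pos (div_pos h2 h1), div_mul_cancel₀ _ h1.ne', smul_smul]
    have : (1 + M / (‖q‖ - M)) * ((‖q‖ - M) / ‖q‖) = 1 := by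
      field_simp
      ring
    rw [this, one_smul]
  · rintro ⟨y, hy, rfl⟩
    have h1 : 0 < ‖y‖ := norm_pos_iff.2 hy
    rw [norm_smul, Real.norm_eq_abs, abs_of_pos (by positivity), add_mul, div_mul_cancel₀ _ h1.ne']
    linarith

/-- A property of intervals that holds for short intervals, passes to subintervals and to the
union of two overlapping intervals holds for all intervals. -/
theorem interval_induction {P : ℝ → ℝ → Prop}
    (mono : ∀ {a b a' b'}, P a b → a ≤ a' → b' ≤ b → P a' b')
    (glue : ∀ {a b b' c}, P a b → P b' c → b' < b → P a c)
    (loc : ∀ x, ∃ ε > 0, P (x - ε) (x + ε)) (a b : ℝ) : P a b := by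
  by_contra hab
  have hbd : BddAbove {y | P a y} :=
    ⟨b, fun y hy => le_of_not_gt fun h => hab (mono hy le_rfl h.le)⟩
  -- A short good interval around the supremum of the ends reachable from `a` can be glued on and
  -- passes this supremum.
  obtain ⟨ε, h0, h1⟩ := loc (sSup {y | P a y})
  have hne : {y | P a y}.Nonempty := by
    obtain ⟨δ, h2, h3⟩ := loc a
    exact ⟨a, mono h3 (by linarith) (by linarith)⟩
  obtain ⟨y, h2, h3⟩ := exists_lt_of_lt_csSup hne (sub_lt_self _ h0)
  have := le_csSup hbd (show sSup {y | P a y} + ε ∈ {y | P a y} from glue h2 h1 h3)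
  linarith

namespace LinkDiagram

variable {D : LinkDiagram}

theorem Regular.eventually_sides {v : Fin D.n} {t : ℝ} (h : D.Regular v t) :
    ∀ᶠ δ : ℝ in 𝓝[>] 0, D.planePoint v t - δ • D.normal v ∉ D.shadow ∧
      D.planePoint v t + δ • D.normal v ∉ D.shadow := by
  have hp := D.cross_normal_pos v
  have h1 := D.eventually_ray (p := D.planePoint v t) (u := D.normal v) (by
    intro u s hs e
    obtain ⟨rfl, -⟩ := h.through hs e
    exact hp.ne')
  have h2 := D.eventually_ray (p := D.planePoint v t) (u := (-1 : ℝ) • D.normal v) (by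
    intro u s hs e
    obtain ⟨rfl, -⟩ := h.through hs e
    rw [cross_smul_right]
    linarith)
  filter_upwards [h1, h2] with δ h1 h2
  refine ⟨?_, h1⟩
  rwa [neg_one_smul, smul_neg, ← sub_eq_add_neg] at h2

/-- Both conditions only involve values off the shadow: near a regular point the two sides along the
normal avoid it. -/
theorem GoodAt.congr {c c' : Plane → As D.FundamentalQuandle} {p : Plane} (h : D.GoodAt c p)
    (e : ∀ᶠ q in 𝓝 p, q ∉ D.shadow → c' q = c q) : D.GoodAt c' p := by
  refine ⟨fun hp => ?_, fun v t a h1 h2 h3 => ?_⟩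
  · filter_upwards [h.locConst hp, e, D.eventually_notMem_shadow hp] with q h1 h2 h3
    rw [h2 h3, h1, e.self_of_nhds hp]
  · filter_upwards [h.jump v t a h1 h2 h3, h2 ▸ h1.eventually_sides,
      (tendsto_sub_smul p (D.normal v)).eventually e,
      (tendsto_add_smul p (D.normal v)).eventually e] with δ h4 h5 h6 h7
    rw [h6 h5.1, h7 h5.2, h4]

theorem GoodAt.mul_left {c : Plane → As D.FundamentalQuandle} {p : Plane} (h : D.GoodAt c p)
    (g : As D.FundamentalQuandle) : D.GoodAt (fun q => g * c q) p := by
  refine ⟨fun hp => ?_, fun v t a h1 h2 h3 => ?_⟩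
  · filter_upwards [h.locConst hp] with q h1
    rw [h1]
  · filter_upwards [h.jump v t a h1 h2 h3] with δ h4
    rw [← h4, mul_assoc]

variable {c c' : Plane → As D.FundamentalQuandle}

theorem exists_ratio_of_notMem {p : Plane} (hp : p ∉ D.shadow) (h : D.GoodAt c p)
    (h' : D.GoodAt c' p) : ∃ g, ∀ᶠ q in 𝓝 p, q ∉ D.shadow → c q * (c' q)⁻¹ = g := by
  refine ⟨c p * (c' p)⁻¹, ?_⟩
  filter_upwards [h.locConst hp, h'.locConst hp] with q h1 h2 _
  rw [h1, h2]

/-- The quotient `c * c'⁻¹` is constant on either half of a small ball. Passing over the edge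
multiplies `c` and `c'` on the right by the same generator, which cancels in the quotient. -/
theorem exists_ratio_of_regular {v : Fin D.n} {t : ℝ} (hr : D.Regular v t)
    (h : ∀ᶠ q in 𝓝 (D.planePoint v t), D.GoodAt c q)
    (h' : ∀ᶠ q in 𝓝 (D.planePoint v t), D.GoodAt c' q) :
    ∃ g, ∀ᶠ q in 𝓝 (D.planePoint v t), q ∉ D.shadow → c q * (c' q)⁻¹ = g := by
  set p := D.planePoint v t with hp
  obtain ⟨ε, hε, hB⟩ := Metric.eventually_nhds_iff_ball.1
    (h.and (h'.and hr.eventually_mem_shadow_iff))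
  have hlin : IsLinearMap ℝ (cross (D.dir v)) :=
    ⟨fun x y => cross_add_right _ x y, fun k x => cross_smul_right _ x k⟩
  have key : ∀ S : Set Plane, Convex ℝ S → S ⊆ Metric.ball p ε →
      (∀ q ∈ S, cross (D.dir v) (q - p) ≠ 0) → ∃ g, ∀ q ∈ S, c q * (c' q)⁻¹ = g := by
    intro S hS hSB h0
    have hn : ∀ q ∈ S, q ∉ D.shadow := fun q hq hs =>
      h0 q hq ((hB q (hSB hq)).2.2.1.1 hs)
    obtain ⟨g, hg⟩ := exists_const_of_isPreconnected hS.isPreconnected D.frequently_notMem_shadow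
      (k := fun q => c q * (c' q)⁻¹) fun q hq =>
        exists_ratio_of_notMem (hn q hq) (hB q (hSB hq)).1 (hB q (hSB hq)).2.1
    exact ⟨g, fun q hq => (hg q hq).self_of_nhds (hn q hq)⟩
  have hcr : ∀ q, cross (D.dir v) (q - p) = cross (D.dir v) q - cross (D.dir v) p :=
    fun q => cross_sub_right _ _ _
  obtain ⟨g, hg⟩ := key (Metric.ball p ε ∩ {q | cross (D.dir v) p < cross (D.dir v) q})
    ((convex_ball _ _).inter (convex_halfSpace_gt hlin _)) Set.inter_subset_left
    (fun q hq => by rw [hcr]; exact (sub_pos.2 hq.2).ne')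
  obtain ⟨g', hg'⟩ := key (Metric.ball p ε ∩ {q | cross (D.dir v) q < cross (D.dir v) p})
    ((convex_ball _ _).inter (convex_halfSpace_lt hlin _)) Set.inter_subset_left
    (fun q hq => by rw [hcr]; exact (sub_neg.2 hq.2).ne)
  have hgg : g' = g := by
    have hO : D.OnArc (D.edgePoint v t) _ :=
      ⟨⟨D.edgePoint_mem_carrier v hr.mem_Icc, hr.notMem_underPoints⟩, rfl⟩
    have hb := Metric.ball_mem_nhds p hε
    obtain ⟨δ, h1, h2, h3, h4, h5⟩ := ((h.self_of_nhds.jump v t _ hr rfl hO).and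
      ((h'.self_of_nhds.jump v t _ hr rfl hO).and
      (((tendsto_sub_smul p (D.normal v)).eventually hb).and
      (((tendsto_add_smul p (D.normal v)).eventually hb).and self_mem_nhdsWithin)))).exists
    have h6 : 0 < δ * cross (D.dir v) (D.normal v) := mul_pos h5 (D.cross_normal_pos v)
    rw [← hg (p + δ • D.normal v) ⟨h4, ?_⟩, ← hg' (p - δ • D.normal v) ⟨h3, ?_⟩, ← h1, ← h2]
    · group
    · simp only [Set.mem_ofPred_eq, cross_sub_right, cross_smul_right]; linarith
    · simp only [Set.mem_ofPred_eq, cross_add_right, cross_smul_right]; linarith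
  refine ⟨g, ?_⟩
  filter_upwards [Metric.ball_mem_nhds p hε] with q hq hs
  have h0 : cross (D.dir v) (q - p) ≠ 0 := fun h0 => hs ((hB q hq).2.2.1.2 h0)
  rw [hcr, sub_ne_zero] at h0
  rcases h0.lt_or_gt with h0 | h0
  · exact (hg' q ⟨hq, h0⟩).trans hgg
  · exact hg q ⟨hq, h0⟩

/-- Vertices and crossings are finite in number, so a small punctured ball contains none, and it is
connected. Hence the quotient is constant around them too, without any analysis of the point itself.
-/
theorem exists_ratio {p : Plane} (h : ∀ᶠ q in 𝓝 p, D.GoodAt c q)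
    (h' : ∀ᶠ q in 𝓝 p, D.GoodAt c' q) :
    ∃ g, ∀ᶠ q in 𝓝 p, q ∉ D.shadow → c q * (c' q)⁻¹ = g := by
  by_cases hp : p ∈ D.shadow
  swap
  · exact exists_ratio_of_notMem hp h.self_of_nhds h'.self_of_nhds
  have hf := (D.finite_irregular.subset (Set.sdiff_subset (t := {p}))).isClosed.isOpen_compl
  obtain ⟨ε, hε, hB⟩ := Metric.eventually_nhds_iff_ball.1
    ((eventually_eventually_nhds.2 h).and ((eventually_eventually_nhds.2 h').and
      (hf.mem_nhds (show p ∈ _ by simp))))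
  obtain ⟨g, hg⟩ := exists_const_of_isPreconnected (isPreconnected_ball_diff_center p ε)
    D.frequently_notMem_shadow (k := fun q => c q * (c' q)⁻¹) (by
      rintro q ⟨hq, hqp⟩
      obtain ⟨h1, h2, h3⟩ := hB q hq
      by_cases hs : q ∈ D.shadow
      · by_cases h4 : ∃ v t, D.Regular v t ∧ D.planePoint v t = q
        · obtain ⟨v, t, hr, rfl⟩ := h4
          exact exists_ratio_of_regular hr h1 h2
        · exact (h3 ⟨⟨hs, h4⟩, hqp⟩).elim
      · exact exists_ratio_of_notMem hs h1.self_of_nhds h2.self_of_nhds)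
  refine ⟨g, ?_⟩
  filter_upwards [Metric.ball_mem_nhds p hε] with q hq hs
  exact (hg q ⟨hq, fun e => hs (e ▸ hp)⟩).self_of_nhds hs

/-- Two solutions on a connected open set differ by a constant. -/
theorem exists_eq_mul {U : Set Plane} (hU : IsOpen U) (hU' : IsPreconnected U)
    (h : ∀ q ∈ U, D.GoodAt c q) (h' : ∀ q ∈ U, D.GoodAt c' q) :
    ∃ g, ∀ q ∈ U, q ∉ D.shadow → c q = g * c' q := by
  obtain ⟨g, hg⟩ := exists_const_of_isPreconnected hU' D.frequently_notMem_shadow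
    (k := fun q => c q * (c' q)⁻¹) fun q hq => exists_ratio
      (mem_of_superset (hU.mem_nhds hq) h) (mem_of_superset (hU.mem_nhds hq) h')
  exact ⟨g, fun q hq hs => mul_inv_eq_iff_eq_mul.1 ((hg q hq).self_of_nhds hs)⟩

variable (D) in
/-- There is a solution on the set `U`. -/
def Solvable (U : Set Plane) : Prop := ∃ c, ∀ q ∈ U, D.GoodAt c q

theorem Solvable.mono {U V : Set Plane} (h : D.Solvable U) (hV : V ⊆ U) : D.Solvable V :=
  h.imp fun _ hc q hq => hc q (hV hq)

/-- On the connected overlap the solutions differ by a left factor. Jumps act on the right, so the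
second solution can be corrected by that factor. -/
theorem Solvable.union {U V : Set Plane} (hU : IsOpen U) (hV : IsOpen V)
    (hUV : IsPreconnected (U ∩ V)) (h : D.Solvable U) (h' : D.Solvable V) :
    D.Solvable (U ∪ V) := by
  classical
  obtain ⟨c, hc⟩ := h
  obtain ⟨c', hc'⟩ := h'
  obtain ⟨g, hg⟩ := exists_eq_mul (hU.inter hV) hUV (fun q hq => hc q hq.1)
    (fun q hq => hc' q hq.2)
  refine ⟨fun q => if q ∈ U then c q else g * c' q, fun q hq => ?_⟩
  by_cases hqU : q ∈ U
  · refine (hc q hqU).congr ?_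
    filter_upwards [hU.mem_nhds hqU] with q' h1 _
    rw [if_pos h1]
  · have hqV := hq.resolve_left hqU
    refine ((hc' q hqV).mul_left g).congr ?_
    filter_upwards [hV.mem_nhds hqV] with q' h1 h2
    split_ifs with h3
    · exact hg q' ⟨h3, h1⟩ h2
    · rfl

/-- Intersections of rectangles are convex, so solutions on overlapping ones glue. Horizontal
induction extends a local solution to a thin strip around each height `y`; vertical induction stacks
the strips. -/
theorem solvable_rectangle (a b a' b' : ℝ) : D.Solvable (Set.Ioo a b ×ˢ Set.Ioo a' b') := by
  have hpre : ∀ a b a' b' a₁ b₁ a₁' b₁' : ℝ, IsPreconnected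
      ((Set.Ioo a b ×ˢ Set.Ioo a' b') ∩ (Set.Ioo a₁ b₁ ×ˢ Set.Ioo a₁' b₁')) :=
    fun a b a' b' a₁ b₁ a₁' b₁' => (((convex_Ioo a b).prod (convex_Ioo a' b')).inter
      ((convex_Ioo a₁ b₁).prod (convex_Ioo a₁' b₁'))).isPreconnected
  refine interval_induction (P := fun a' b' => D.Solvable (Set.Ioo a b ×ˢ Set.Ioo a' b'))
    (fun h h1 h2 => h.mono (Set.prod_mono le_rfl (Set.Ioo_subset_Ioo h1 h2))) ?_ ?_ a' b'
  · intro a₁ b₁ b₂ c h h' hlt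
    refine (h.union (isOpen_Ioo.prod isOpen_Ioo) (isOpen_Ioo.prod isOpen_Ioo)
      (hpre _ _ _ _ _ _ _ _) h').mono ?_
    rintro ⟨x, y⟩ ⟨hx, hy⟩
    rcases lt_or_ge y b₁ with h1 | h1
    · exact .inl ⟨hx, hy.1, h1⟩
    · exact .inr ⟨hx, hlt.trans_le h1, hy.2⟩
  · intro y
    refine interval_induction
      (P := fun a b => ∃ ε > 0, D.Solvable (Set.Ioo a b ×ˢ Set.Ioo (y - ε) (y + ε)))
      ?_ ?_ ?_ a b
    · rintro a b a' b' ⟨ε, h0, h⟩ h1 h2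
      exact ⟨ε, h0, h.mono (Set.prod_mono (Set.Ioo_subset_Ioo h1 h2) le_rfl)⟩
    · rintro a b b' c ⟨ε, h0, h⟩ ⟨ε', h0', h'⟩ hlt
      refine ⟨min ε ε', lt_min h0 h0', (h.union (isOpen_Ioo.prod isOpen_Ioo)
        (isOpen_Ioo.prod isOpen_Ioo) (hpre _ _ _ _ _ _ _ _) h').mono ?_⟩
      rintro ⟨x, z⟩ ⟨hx, hz1, hz2⟩
      have m1 := min_le_left ε ε'
      have m2 := min_le_right ε ε'
      simp only at hz1 hz2
      rcases lt_or_ge x b with h1 | h1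
      · exact .inl ⟨⟨hx.1, h1⟩, by simp only; linarith, by simp only; linarith⟩
      · exact .inr ⟨⟨hlt.trans_le h1, hx.2⟩, by simp only; linarith, by simp only; linarith⟩
    · intro x
      obtain ⟨c, hc⟩ := D.exists_goodAt (x, y)
      obtain ⟨ε, h0, h⟩ := Metric.eventually_nhds_iff_ball.1 hc
      refine ⟨ε, h0, ε, h0, c, fun q hq => h q ?_⟩
      rw [← ball_prod_same, Real.ball_eq_Ioo, Real.ball_eq_Ioo]
      exact hq

variable (D)

theorem exists_bound : ∃ M > 0, ∀ q ∈ D.shadow, |q.1| < M ∧ |q.2| < M := by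
  have hc : IsCompact (⋃ v : Fin D.n, D.planePoint v '' Set.Icc (0 : ℝ) 1) :=
    isCompact_iUnion fun v => isCompact_Icc.image (D.continuous_planePoint v)
  obtain ⟨M, h0, hM⟩ := hc.isBounded.subset_ball_lt 0 (0 : Plane)
  refine ⟨M, h0, fun q hq => ?_⟩
  obtain ⟨v, t, ht, e⟩ := D.mem_shadow_iff.1 hq
  have := hM (Set.mem_iUnion.2 ⟨v, t, ht, e⟩)
  rw [mem_ball_zero_iff] at this
  exact ⟨(norm_fst_le q).trans_lt this, (norm_snd_le q).trans_lt this⟩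

/-- A solution on a rectangle around the shadow is extended by precomposing it with the retraction
`F` of the plane onto the square `[-M, M]²`, which is the identity near the shadow. -/
theorem solvable_univ : D.Solvable Set.univ := by
  obtain ⟨M, h0, hM⟩ := D.exists_bound
  obtain ⟨c, hc⟩ := solvable_rectangle (D := D) (-(M + 1)) (M + 1) (-(M + 1)) (M + 1)
  let f : ℝ → ℝ := fun x => max (-M) (min M x)
  have hf : Continuous f := by fun_prop
  have hf1 : ∀ x, f x ∈ Set.Ioo (-(M + 1)) (M + 1) := fun x =>
    ⟨(by linarith : -(M + 1) < -M).trans_le (le_max_left _ _),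
      max_lt (by linarith) ((min_le_left _ _).trans_lt (by linarith))⟩
  have hf2 : ∀ x, |x| < M → f x = x := fun x hx => by
    rw [abs_lt] at hx
    simp only [f, min_eq_right hx.2.le, max_eq_right hx.1.le]
  have hf3 : ∀ x, |f x| < M → f x = x := by
    intro x hx
    rw [abs_lt] at hx
    rcases le_total M x with h | h
    · have : f x = M := by simp only [f, min_eq_left h]; exact max_eq_right (by linarith)
      rw [this] at hx
      exact absurd hx.2 (lt_irrefl _)
    · simp only [f, min_eq_right h] at hx ⊢
      rcases le_total (-M) x with h' | h'
      · exact max_eq_right h'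
      · rw [max_eq_left h'] at hx
        exact absurd hx.1 (lt_irrefl _)
  let F : Plane → Plane := fun q => (f q.1, f q.2)
  have hF : Continuous F := by fun_prop
  -- A point moved by `F` lands on the boundary of the square, where there is no shadow.
  have hFs : ∀ q, F q ∈ D.shadow → F q = q := fun q h =>
    Prod.ext (hf3 _ (hM _ h).1) (hf3 _ (hM _ h).2)
  refine ⟨c ∘ F, fun q _ => ?_⟩
  have hq := hc (F q) ⟨hf1 _, hf1 _⟩
  by_cases hs : q ∈ D.shadow
  · have hb := hM q hs
    have hFq : F q = q := Prod.ext (hf2 _ hb.1) (hf2 _ hb.2)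
    rw [hFq] at hq
    refine hq.congr ?_
    have o1 : IsOpen {q' : Plane | |q'.1| < M} := isOpen_lt (by fun_prop) continuous_const
    have o2 : IsOpen {q' : Plane | |q'.2| < M} := isOpen_lt (by fun_prop) continuous_const
    filter_upwards [o1.mem_nhds hb.1, o2.mem_nhds hb.2] with q' h1 h2 _
    exact congrArg c (Prod.ext (hf2 _ h1) (hf2 _ h2))
  · refine ⟨fun _ => ?_, fun v t a h1 h2 _ => ?_⟩
    · exact (hF.tendsto q).eventually (hq.locConst fun h => hs (hFs q h ▸ h))
    · exact (hs (h2 ▸ D.planePoint_mem_shadow v h1.mem_Icc)).elim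

variable {D}

theorem InRegion.unique {q : Plane} {r r' : D.Region} (h : D.InRegion q r)
    (h' : D.InRegion q r') : r = r' := by
  obtain ⟨_, rfl⟩ := h
  obtain ⟨_, rfl⟩ := h'
  rfl

theorem InRegion.of_isPreconnected {S : Set Plane} (hS : IsPreconnected S)
    (hn : ∀ q ∈ S, q ∉ D.shadow) {q q' : Plane} (hq : q ∈ S) (hq' : q' ∈ S) {r : D.Region}
    (h : D.InRegion q r) : D.InRegion q' r := by
  obtain ⟨hq0, rfl⟩ := h
  have : IsPreconnected ((↑) ⁻¹' S : Set {q : Plane // q ∉ D.shadow}) := by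
    refine Topology.IsInducing.subtypeVal.isPreconnected_image.1 ?_
    convert hS using 1
    ext q
    exact ⟨fun ⟨_, h1, h2⟩ => h2 ▸ h1, fun h => ⟨⟨q, hn q h⟩, h, rfl⟩⟩
  exact ⟨hn q' hq', ConnectedComponents.coe_eq_coe'.2
    (this.subset_connectedComponent (x := ⟨q, hq0⟩) hq hq')⟩

variable (D)

/-- Two unbounded regions both meet the exterior of a ball containing the shadow, and this exterior
is connected. -/
theorem region_eq_of_unbounded {r r' : D.Region}
    (h : ¬ Bornology.IsBounded {q | D.InRegion q r})
    (h' : ¬ Bornology.IsBounded {q | D.InRegion q r'}) : r = r' := by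
  obtain ⟨M, h0, hM⟩ := D.exists_bound
  have key : ∀ r : D.Region, ¬ Bornology.IsBounded {q | D.InRegion q r} →
      ∃ q, D.InRegion q r ∧ M < ‖q‖ := by
    intro r hr
    by_contra! hcon
    exact hr ((Metric.isBounded_closedBall (x := (0 : Plane)) (r := M)).subset fun q hq => by
      rw [mem_closedBall_zero_iff]; exact hcon q hq)
  obtain ⟨q, hq, hqM⟩ := key r h
  obtain ⟨q', hq', hqM'⟩ := key r' h'
  refine (InRegion.of_isPreconnected (isPreconnected_lt_norm h0) (fun p hp hs => ?_) hqM hqM'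
    hq).unique hq'
  obtain ⟨h1, h2⟩ := hM p hs
  exact (max_lt h1 h2).not_gt hp

/-- The map from the regions to the associated group exists. -/
theorem exists_isRegionMap : ∃ c, D.IsRegionMap c := by
  obtain ⟨c, hc⟩ := D.solvable_univ
  have hl : IsLocallyConstant fun q : {q : Plane // q ∉ D.shadow} => c q := by
    refine (IsLocallyConstant.iff_eventually_eq _).2 fun q => ?_
    exact (continuous_subtype_val.tendsto q).eventually ((hc q trivial).locConst q.2)
  choose rep hrep using fun r : D.Region => ConnectedComponents.surjective_coe r
  have hr : ∀ q r, D.InRegion q r → c (rep r) = c q := by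
    rintro q _ ⟨hq, rfl⟩
    have := ConnectedComponents.coe_eq_coe'.1 (hrep (ConnectedComponents.mk ⟨q, hq⟩))
    exact hl.apply_eq_of_isPreconnected isPreconnected_connectedComponent this
      mem_connectedComponent
  -- Normalisation at the unbounded region by a left translation, which preserves the jump
  -- conditions.
  obtain ⟨g, hg⟩ : ∃ g, ∀ r, ¬ Bornology.IsBounded {q | D.InRegion q r} → g * c (rep r) = 1 := by
    by_cases h : ∃ r, ¬ Bornology.IsBounded {q | D.InRegion q r}
    · obtain ⟨r₀, h0⟩ := h
      exact ⟨(c (rep r₀))⁻¹, fun r h => by rw [D.region_eq_of_unbounded h h0, inv_mul_cancel]⟩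
    · exact ⟨1, fun r h' => (h ⟨r, h'⟩).elim⟩
  refine ⟨fun r => g * c (rep r), hg, fun P a r₁ r₂ h0 hP ha h1 h2 => ?_⟩
  have hreg : D.Regular P.1 P.2 := ⟨h0, P.2.2.2, fun Q hQ => by
    rw [hP Q (by rw [hQ, D.point_fst_eq])]; exact ⟨rfl, rfl⟩⟩
  obtain ⟨δ, h3, h4, h5⟩ :=
    (h1.and (h2.and ((hc _ trivial).jump P.1 P.2 a hreg (D.point_fst_eq P).symm ha))).exists
  change g * c (rep r₁) * D.arcElt a = g * c (rep r₂)
  rw [hr _ _ h3, hr _ _ h4, ← h5, mul_assoc]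

theorem isRegionMap_regionMap : D.IsRegionMap D.regionMap :=
  Classical.epsilon_spec D.exists_isRegionMap

open Classical in
/-- The region map as a function on the plane. -/
def regionFun (q : Plane) : As D.FundamentalQuandle :=
  if h : q ∉ D.shadow then D.regionMap (ConnectedComponents.mk ⟨q, h⟩) else 1

variable {D}

theorem InRegion.regionFun_eq {q : Plane} {r : D.Region} (h : D.InRegion q r) :
    D.regionFun q = D.regionMap r := by
  obtain ⟨h, rfl⟩ := h
  exact dif_pos h

theorem eventually_inRegion {p : Plane} (hp : p ∉ D.shadow) :
    ∀ᶠ q in 𝓝 p, D.InRegion q (ConnectedComponents.mk ⟨p, hp⟩) := by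
  obtain ⟨ε, h0, h⟩ := Metric.eventually_nhds_iff_ball.1 (D.eventually_notMem_shadow hp)
  filter_upwards [Metric.ball_mem_nhds p h0] with q hq
  exact InRegion.of_isPreconnected Metric.isPreconnected_ball h (Metric.mem_ball_self h0) hq
    ⟨hp, rfl⟩

/-- The points of a ray that lies off the shadow near its end point are in a single region. -/
theorem exists_region_of_ray {p u : Plane} (h : ∀ᶠ δ : ℝ in 𝓝[>] 0, p + δ • u ∉ D.shadow) :
    ∃ r, ∀ᶠ δ : ℝ in 𝓝[>] 0, D.InRegion (p + δ • u) r := by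
  obtain ⟨ε, h0, hε⟩ := mem_nhdsGT_iff_exists_Ioo_subset.1 h
  have hε' : (0 : ℝ) < ε := h0
  have hc : Continuous fun δ : ℝ => p + δ • u := by fun_prop
  have hS := (isPreconnected_Ioo (a := (0 : ℝ)) (b := ε)).image _ hc.continuousOn
  have hn : ∀ q ∈ (fun δ : ℝ => p + δ • u) '' Set.Ioo 0 ε, q ∉ D.shadow := by
    rintro _ ⟨δ, hδ, rfl⟩
    exact hε hδ
  have hm : ε / 2 ∈ Set.Ioo 0 ε := ⟨by linarith, by linarith⟩
  refine ⟨ConnectedComponents.mk ⟨_, hn _ ⟨_, hm, rfl⟩⟩, ?_⟩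
  filter_upwards [Ioo_mem_nhdsGT hε'] with δ hδ
  exact InRegion.of_isPreconnected hS hn ⟨_, hm, rfl⟩ ⟨δ, hδ, rfl⟩ ⟨_, rfl⟩

variable (D)

theorem goodAt_regionFun (p : Plane) : D.GoodAt D.regionFun p := by
  refine ⟨fun hp => ?_, fun v t a h1 h2 h3 => ?_⟩
  · filter_upwards [eventually_inRegion hp] with q hq
    rw [hq.regionFun_eq, InRegion.regionFun_eq ⟨hp, rfl⟩]
  · obtain ⟨r₂, hr₂⟩ := exists_region_of_ray (h1.eventually_sides.mono fun _ h => h.2)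
    obtain ⟨r₁, hr₁⟩ := exists_region_of_ray (D := D) (p := D.planePoint v t)
      (u := -D.normal v) (by
        filter_upwards [h1.eventually_sides] with δ h
        rw [smul_neg, ← sub_eq_add_neg]
        exact h.1)
    simp only [smul_neg, ← sub_eq_add_neg] at hr₁
    have hP := D.point_fst_eq (v, ⟨t, h1.1.le, h1.2.1⟩)
    have key := D.isRegionMap_regionMap.mul_arc (v, ⟨t, h1.1.le, h1.2.1⟩) a r₁ r₂ h1.1
      (fun Q hQ => by
        obtain ⟨e1, e2⟩ := h1.2.2 Q (hQ.trans hP)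
        exact Prod.ext e1 (Subtype.ext e2)) h3 (by rw [hP]; exact hr₁) (by rw [hP]; exact hr₂)
    subst h2
    filter_upwards [hr₁, hr₂] with δ h4 h5
    rw [h4.regionFun_eq, h5.regionFun_eq]
    exact key

end LinkDiagram

/-! ### Jumps of a function of the regions along the link. -/

/-- The sum of the jumps of a piecewise constant function on the unit interval. -/
theorem sum_jumps {ι A : Type*} [AddCommGroup A] {h : ℝ → A} {T : Finset ι} {time : ι → ℝ}
    {J : ι → A} {a b : A} (hT : ∀ i ∈ T, time i ∈ Set.Ioo (0 : ℝ) 1)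
    (hinj : ∀ i ∈ T, ∀ j ∈ T, time i = time j → i = j)
    (h0 : ∀ᶠ s in 𝓝[>] 0, h s = a) (h1 : ∀ᶠ s in 𝓝[<] 1, h s = b)
    (hreg : ∀ t ∈ Set.Ioo (0 : ℝ) 1, (∀ i ∈ T, time i ≠ t) → ∃ m, ∀ᶠ s in 𝓝 t, h s = m)
    (hjump : ∀ i ∈ T, ∃ l, ∀ᶠ s in 𝓝 (time i),
      (s < time i → h s = l) ∧ (time i < s → h s = l + J i)) :
    b = a + ∑ i ∈ T, J i := by
  classical
  -- Subtracting the jumps already passed leaves a function without jumps, so it is constant off the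
  -- jump times; comparing it near `0` and near `1` gives the claim.
  set step : ℝ → A := fun s => ∑ i ∈ T, if time i < s then J i else 0 with hstep
  have hZ : (time '' T : Set ℝ).Finite := T.finite_toSet.image _
  have hd : ∀ q, ∃ᶠ q' in 𝓝 q, q' ∉ (time '' T : Set ℝ) := fun q =>
    mem_closure_iff_frequently.1 ((hZ.countable.dense_compl ℝ) q)
  have hnear : ∀ q, ∀ᶠ s in 𝓝 q, ∀ i ∈ T, time i ≠ q → (time i < s ↔ time i < q) := by
    intro q
    rw [Filter.eventually_all_finset]
    intro i _
    rcases lt_trichotomy (time i) q with h | h | h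
    · filter_upwards [lt_mem_nhds h] with s hs _ using iff_of_true hs h
    · exact .of_forall fun s hs => (hs h).elim
    · filter_upwards [gt_mem_nhds h] with s hs _ using iff_of_false hs.not_gt h.not_gt
  obtain ⟨g, hg⟩ := exists_const_of_isPreconnected (isPreconnected_Ioo (a := (0 : ℝ)) (b := 1)) hd
    (k := fun s => h s - step s) (by
      intro q hq
      by_cases hqT : ∃ i ∈ T, time i = q
      · obtain ⟨i, hi, rfl⟩ := hqT
        obtain ⟨l, hl⟩ := hjump i hi
        refine ⟨l - step (time i), ?_⟩
        filter_upwards [hl, hnear (time i)] with s hs hn hsT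
        have hne : s ≠ time i := fun e => hsT ⟨i, hi, e.symm⟩
        rcases hne.lt_or_gt with h2 | h2
        · have : step s = step (time i) := Finset.sum_congr rfl fun j hj => by
            by_cases hji : time j = time i
            · rw [hji, if_neg h2.not_gt, if_neg (lt_irrefl _)]
            · simp only [hn j hj hji]
          rw [hs.1 h2, this]
        · have : step s = step (time i) + J i := by
            have e : J i = ∑ j ∈ T, if j = i then J i else 0 := by
              rw [Finset.sum_ite_eq', if_pos hi]
            rw [e, hstep, ← Finset.sum_add_distrib]
            refine Finset.sum_congr rfl fun j hj => ?_
            by_cases hji : j = i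
            · rw [hji, if_pos h2, if_neg (lt_irrefl _), if_pos rfl, zero_add]
            · simp only [hn j hj fun e => hji (hinj j hj i hi e), if_neg hji, add_zero]
          rw [hs.2 h2, this]
          abel
      · have hq' : ∀ i ∈ T, time i ≠ q := fun i hi e => hqT ⟨i, hi, e⟩
        obtain ⟨m, hm⟩ := hreg q hq hq'
        refine ⟨m - step q, ?_⟩
        filter_upwards [hm, hnear q] with s hs hn _
        have : step s = step q := Finset.sum_congr rfl fun j hj => by simp only [hn j hj (hq' j hj)]
        rw [hs, this])
  have hg' : ∀ s ∈ Set.Ioo (0 : ℝ) 1, s ∉ (time '' T : Set ℝ) → h s - step s = g :=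
    fun s hs hsT => (hg s hs).self_of_nhds hsT
  have ha : a = g := by
    have e : ∀ᶠ s in 𝓝[>] (0 : ℝ), ∀ i ∈ T, s < time i := by
      rw [Filter.eventually_all_finset]
      exact fun i hi => nhdsWithin_le_nhds (gt_mem_nhds (hT i hi).1)
    obtain ⟨s, hs, hs', hs''⟩ := (h0.and (e.and (Ioo_mem_nhdsGT one_pos))).exists
    rw [← hg' s hs'' (by rintro ⟨i, hi, e⟩; exact (hs' i hi).ne e.symm), hs]
    simp only [hstep]
    rw [Finset.sum_eq_zero fun i hi => if_neg (hs' i hi).not_gt, sub_zero]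
  have hb : b - ∑ i ∈ T, J i = g := by
    have e : ∀ᶠ s in 𝓝[<] (1 : ℝ), ∀ i ∈ T, time i < s := by
      rw [Filter.eventually_all_finset]
      exact fun i hi => nhdsWithin_le_nhds (lt_mem_nhds (hT i hi).2)
    obtain ⟨s, hs, hs', hs''⟩ := (h1.and (e.and (Ioo_mem_nhdsLT one_pos))).exists
    rw [← hg' s hs'' (by rintro ⟨i, hi, e⟩; exact (hs' i hi).ne e), hs]
    simp only [hstep]
    rw [Finset.sum_congr rfl fun i hi => if_pos (hs' i hi)]
  rw [ha, ← hb, sub_add_cancel]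

namespace LinkDiagram

variable (D : LinkDiagram)

/-- The region to the right of the edge that starts at `v`, at time `t`, has the value `g`. -/
def RightVal (v : Fin D.n) (t : ℝ) (g : As D.FundamentalQuandle) : Prop :=
  ∀ᶠ δ : ℝ in 𝓝[>] 0, D.regionFun (D.planePoint v t - δ • D.normal v) = g

variable {D}

theorem RightVal.unique {v : Fin D.n} {t : ℝ} {g g' : As D.FundamentalQuandle}
    (h : D.RightVal v t g) (h' : D.RightVal v t g') : g = g' := by
  obtain ⟨δ, h1, h2⟩ := (h.and h').exists
  exact h1.symm.trans h2

/-- The right values near a point with a known local solution `c`. -/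
theorem exists_rightVal_of_goodAt {p : Plane} {c : Plane → As D.FundamentalQuandle}
    (hc : ∀ᶠ q in 𝓝 p, D.GoodAt c q) : ∃ g,
      (∀ᶠ q in 𝓝 p, q ∉ D.shadow → D.regionFun q = g * c q) ∧
      ∀ᶠ q in 𝓝 p, ∀ u t x, D.Regular u t → D.planePoint u t = q →
        (∀ᶠ δ : ℝ in 𝓝[>] 0, c (q - δ • D.normal u) = x) → D.RightVal u t (g * x) := by
  obtain ⟨g, hg⟩ := exists_ratio (.of_forall D.goodAt_regionFun) hc
  refine ⟨g, hg.mono fun q h1 h2 => mul_inv_eq_iff_eq_mul.1 (h1 h2), ?_⟩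
  filter_upwards [eventually_eventually_nhds.2 hg] with q hq u t x h1 h2 h3
  subst h2
  filter_upwards [(tendsto_sub_smul _ (D.normal u)).eventually hq, h3, h1.eventually_sides]
    with δ h4 h5 h6
  rw [mul_inv_eq_iff_eq_mul.1 (h4 h6.1), h5]

/-- At regular points and at vertices the value on the right does not change: the local solution is
`1` on the whole right side. -/
theorem IsSideModel.exists_rightVal {p : Plane} {a : D.Arc} {L : Plane → Prop}
    (h : D.IsSideModel p a L) :
    ∃ g, ∀ᶠ q in 𝓝 p, ∀ u t, D.Regular u t → D.planePoint u t = q → D.RightVal u t g := by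
  obtain ⟨g, -, hg⟩ := exists_rightVal_of_goodAt h.goodAt
  refine ⟨g, ?_⟩
  filter_upwards [hg, h] with q h1 h2 u t h3 h4
  rw [← mul_one g]
  refine h1 u t 1 h3 h4 ?_
  filter_upwards [(h2.2 u t _ h3 h4
    ⟨⟨D.edgePoint_mem_carrier u h3.mem_Icc, h3.notMem_underPoints⟩, rfl⟩).2] with δ h5
  exact if_neg h5.1

theorem Regular.not_center {v : Fin D.n} {t : ℝ} (h : D.Regular v t) (τ : D.Crossing) :
    D.planePoint v t ≠ τ.center := by
  intro e
  have r1 := h.2.2 τ.upper e.symm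
  have r2 := h.2.2 τ.lower (by rw [e]; exact τ.proj_eq.symm)
  exact Crossing.fst_ne D τ (r1.1.trans r2.1.symm)

namespace Crossing

variable (τ : D.Crossing)

/-- The direction `sign • (overDir - underDir)` has negative determinant with both strands, so the
ray is transverse to both and stays in one region. -/
theorem isSpecifiedRegion : τ.IsSpecifiedRegion τ.specifiedRegion := by
  have hx := τ.sign_mul_cross_pos
  have hsw := cross_swap τ.underDir τ.overDir
  obtain ⟨r, hr⟩ := exists_region_of_ray (D := D) (p := τ.center)
    (u := (τ.sign : ℝ) • (τ.overDir - τ.underDir)) (D.eventually_ray (by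
      intro u s hs e
      rw [cross_smul_right, cross_sub_right]
      rcases τ.through hs e with ⟨rfl, rfl⟩ | ⟨rfl, rfl⟩
      · change (τ.sign : ℝ) * (cross τ.overDir τ.overDir - cross τ.overDir τ.underDir) ≠ 0
        rw [cross_self]
        intro h; linarith
      · change (τ.sign : ℝ) * (cross τ.underDir τ.overDir - cross τ.underDir τ.underDir) ≠ 0
        rw [cross_self, hsw]
        intro h; linarith))
  refine Classical.epsilon_spec (p := τ.IsSpecifiedRegion) ⟨r, ?_⟩
  filter_upwards [hr] with δ h
  rwa [← smul_smul]

/-- The value of the region map on the specified region. -/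
def regionElt : As D.FundamentalQuandle := D.regionMap τ.specifiedRegion

-- The specified region is the sector where `sectorFun` is `1`, so the region map is `regionElt *
-- sectorFun` near the crossing. The right side of the over strand lies in the specified region
-- after a positive crossing and before a negative one; for the under strand it is the other way
-- round.
open Classical in
theorem eventually_rightVal : ∀ᶠ q in 𝓝 τ.center, ∀ u t, D.Regular u t → D.planePoint u t = q →
    (u = τ.upper.1 → D.RightVal u t (if 0 < τ.sign * (t - τ.upper.2) then τ.regionElt
      else τ.regionElt * D.arcElt τ.sourceArc)) ∧
    (u = τ.lower.1 → D.RightVal u t (if 0 < τ.sign * (t - τ.lower.2) then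
      τ.regionElt * D.arcElt τ.overArc else τ.regionElt)) := by
  have hx := τ.sign_mul_cross_pos
  have hsw := cross_swap τ.underDir τ.overDir
  have hsq : (τ.sign : ℝ) * τ.sign = 1 := by
    rcases τ.sign_cases with h | h <;> rw [h] <;> norm_num
  have hs0 : (τ.sign : ℝ) ≠ 0 := left_ne_zero_of_mul_eq_one hsq
  obtain ⟨c, hc⟩ := τ.exists_isTargetArc
  obtain ⟨g, h1, h2⟩ := exists_rightVal_of_goodAt (τ.goodAt_sectorFun τ.isSourceArc_sourceArc hc)
  have hg : τ.regionElt = g := by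
    have hT := tendsto_add_smul τ.center ((τ.sign : ℝ) • (τ.overDir - τ.underDir))
    obtain ⟨δ, h3, h4, h5⟩ := (τ.isSpecifiedRegion.and
      ((hT.eventually h1).and self_mem_nhdsWithin)).exists
    have h6 : 0 < δ * (τ.sign * cross τ.overDir τ.underDir) := mul_pos h5 hx
    have e := h4 (by rw [smul_smul]; exact h3.1)
    rw [smul_smul, h3.regionFun_eq] at e
    rw [regionElt, e, sectorFun, if_neg, if_neg, mul_one]
    · rw [add_sub_cancel_left, cross_smul_right, cross_sub_right, cross_self, hsw]
      linarith
    · rw [add_sub_cancel_left, cross_smul_right, cross_sub_right, cross_self]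
      linarith
  rw [hg]
  filter_upwards [h2] with q h2 u t h3 h4
  have hnc := h3.not_center τ
  constructor
  · rintro rfl
    have e : q - τ.center = (t - τ.upper.2) • τ.overDir := by
      rw [← h4, τ.center_eq_upper, D.planePoint_eq_add τ.upper.1 τ.upper.2 t, add_sub_cancel_left]
      rfl
    have hr : t - τ.upper.2 ≠ 0 := fun h => hnc (by
      rw [h, zero_smul, sub_eq_zero] at e; rw [h4, e])
    have z1 : cross τ.overDir (q - τ.center) = 0 := by
      rw [e, cross_smul_right, cross_self, mul_zero]
    have z2 : cross τ.underDir (q - τ.center) =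
        -((τ.sign * (t - τ.upper.2)) * (τ.sign * cross τ.overDir τ.underDir)) := by
      rw [e, cross_smul_right, hsw]
      linear_combination ((t - τ.upper.2) * cross τ.overDir τ.underDir) * hsq
    have hc0 := eventually_cross_zero_sides z1 (D.cross_normal_pos τ.upper.1)
    rcases (mul_ne_zero hs0 hr).lt_or_gt with h | h
    · rw [if_neg h.not_gt]
      refine h2 _ t _ h3 h4 ?_
      have z3 : 0 < cross τ.underDir (q - τ.center) := by
        rw [z2, neg_pos]; exact mul_neg_of_neg_of_pos h hx
      filter_upwards [hc0, eventually_cross_pos_sides (D.normal τ.upper.1) z3] with δ w1 w2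
      rw [sectorFun, if_neg w1.1.not_gt, if_pos w2.1]
    · rw [if_pos h, ← mul_one g]
      refine h2 _ t _ h3 h4 ?_
      have z3 : cross τ.underDir (q - τ.center) < 0 := by
        rw [z2, neg_lt_zero]; exact mul_pos h hx
      filter_upwards [hc0, eventually_cross_neg_sides (D.normal τ.upper.1) z3] with δ w1 w2
      rw [sectorFun, if_neg w1.1.not_gt, if_neg w2.1.not_gt]
  · rintro rfl
    have e : q - τ.center = (t - τ.lower.2) • τ.underDir := by
      rw [← h4, τ.center_eq_lower, D.planePoint_eq_add τ.lower.1 τ.lower.2 t, add_sub_cancel_left]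
      rfl
    have hr : t - τ.lower.2 ≠ 0 := fun h => hnc (by
      rw [h, zero_smul, sub_eq_zero] at e; rw [h4, e])
    have z1 : cross τ.underDir (q - τ.center) = 0 := by
      rw [e, cross_smul_right, cross_self, mul_zero]
    have z2 : cross τ.overDir (q - τ.center) =
        (τ.sign * (t - τ.lower.2)) * (τ.sign * cross τ.overDir τ.underDir) := by
      rw [e, cross_smul_right]
      linear_combination (-((t - τ.lower.2) * cross τ.overDir τ.underDir)) * hsq
    have hc0 := eventually_cross_zero_sides z1 (D.cross_normal_pos τ.lower.1)
    rcases (mul_ne_zero hs0 hr).lt_or_gt with h | h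
    · rw [if_neg h.not_gt, ← mul_one g]
      refine h2 _ t _ h3 h4 ?_
      have z3 : cross τ.overDir (q - τ.center) < 0 := by
        rw [z2]; exact mul_neg_of_neg_of_pos h hx
      filter_upwards [hc0, eventually_cross_neg_sides (D.normal τ.lower.1) z3] with δ w1 w2
      rw [sectorFun, if_neg w2.1.not_gt, if_neg w1.1.not_gt]
    · rw [if_pos h]
      refine h2 _ t _ h3 h4 ?_
      have z3 : 0 < cross τ.overDir (q - τ.center) := by
        rw [z2]; exact mul_pos h hx
      filter_upwards [hc0, eventually_cross_pos_sides (D.normal τ.lower.1) z3] with δ w1 w2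
      rw [sectorFun, if_pos w2.1, if_neg w1.1.not_gt, mul_one]

end Crossing

theorem eventually_regular {v : Fin D.n} {t : ℝ} :
    ∀ᶠ s in 𝓝 t, s ≠ t → s ∈ Set.Ioo (0 : ℝ) 1 → D.Regular v s := by
  have hf : {s | s ∈ Set.Ioo (0 : ℝ) 1 ∧ ¬ D.Regular v s}.Finite := by
    refine Set.Finite.of_finite_image (f := D.planePoint v) (D.finite_irregular.subset ?_)
      (D.planePoint_injective v).injOn
    rintro _ ⟨s, ⟨hs, hr⟩, rfl⟩
    have hs' := Set.Ioo_subset_Icc_self hs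
    refine ⟨D.planePoint_mem_shadow v hs', fun ⟨u, r, h1, h2⟩ => hr ?_⟩
    obtain ⟨rfl, rfl⟩ := h1.through hs' h2.symm
    exact h1
  have := (hf.subset (Set.sdiff_subset (t := {t}))).isClosed.isOpen_compl
  filter_upwards [this.mem_nhds (show t ∈ _ by simp)] with s h1 h2 h3
  by_contra h4
  exact h1 ⟨⟨h3, h4⟩, h2⟩

/-- The strands of the crossings: over strands and under strands. -/
def strandParam : D.Crossing ⊕ D.Crossing → D.Param :=
  Sum.elim Crossing.upper Crossing.lower

/-- As there are no triple points, one strand of a crossing determines the other, and no over point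
is an under point. Hence no two jumps on an edge occur at the same time. -/
theorem strandParam_injective : Function.Injective (strandParam (D := D)) := by
  have ext : ∀ τ τ' : D.Crossing, τ.upper = τ'.upper → τ.lower = τ'.lower → τ = τ' := by
    rintro ⟨_, _, _, _⟩ ⟨_, _, _, _⟩ h h'
    simp only at h h'
    subst h h'
    rfl
  have mixed : ∀ τ τ' : D.Crossing, τ.upper ≠ τ'.lower := fun τ τ' h =>
    D.over_not_under τ (h ▸ ⟨τ', rfl⟩)
  rintro (τ | τ) (τ' | τ') h
  · have h : τ.upper = τ'.upper := h
    rw [ext τ τ' h]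
    rcases τ'.eq_or_eq (P := τ.lower) (by rw [← τ.proj_eq, h]; rfl) with e | e
    · exact (mixed τ' τ e.symm).elim
    · exact e
  · exact (mixed τ τ' h).elim
  · exact (mixed τ' τ h.symm).elim
  · have h : τ.lower = τ'.lower := h
    rw [ext τ τ' _ h]
    rcases τ'.eq_or_eq (P := τ.upper) (by rw [τ.proj_eq, h]; exact τ'.proj_eq.symm) with e | e
    · exact e
    · exact (mixed τ τ' e).elim

theorem strandParam_mem_Ioo (x : D.Crossing ⊕ D.Crossing) :
    ((strandParam x).2 : ℝ) ∈ Set.Ioo (0 : ℝ) 1 := by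
  rcases x with τ | τ
  · exact ⟨τ.upper_pos, τ.upper.2.2.2⟩
  · exact ⟨τ.lower_pos, τ.lower.2.2.2⟩

theorem regular_of_forall_strandParam {v : Fin D.n} {t : ℝ} (ht : t ∈ Set.Ioo (0 : ℝ) 1)
    (h : ∀ x : D.Crossing ⊕ D.Crossing, (strandParam x).1 = v → ((strandParam x).2 : ℝ) ≠ t) :
    D.Regular v t := by
  have ht' := Set.Ioo_subset_Icc_self ht
  rcases D.shadow_cases (D.planePoint_mem_shadow v ht') with ⟨u, s, hr, e⟩ | ⟨w, e⟩ | ⟨τ, e⟩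
  · obtain ⟨rfl, rfl⟩ := hr.through ht' e.symm
    exact hr
  · rw [D.planePoint_zero] at e
    rcases D.vertex_through ht' e.symm with ⟨-, rfl⟩ | ⟨-, rfl⟩
    · exact absurd ht.1 (lt_irrefl _)
    · exact absurd ht.2 (lt_irrefl _)
  · rcases τ.through ht' e.symm with ⟨h1, h2⟩ | ⟨h1, h2⟩
    · exact (h (.inl τ) h1.symm h2.symm).elim
    · exact (h (.inr τ) h1.symm h2.symm).elim

/-- The sum over the crossings of the signed difference of any function at the two regions that are
adjacent to the specified region is zero. -/
theorem sum_sign_smul_eq_zero {A : Type*} [AddCommGroup A] (F : As D.FundamentalQuandle → A) :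
    ∑ τ : D.Crossing, τ.sign • (F (τ.regionElt * D.arcElt τ.overArc) -
      F (τ.regionElt * D.arcElt τ.sourceArc)) = 0 := by
  classical
  -- `F` of the region on the right. The arbitrary choice matters only at times without a right
  -- value, and `sum_jumps` ignores the values at the jump times.
  let f : Fin D.n → ℝ → A := fun v t => F (Classical.epsilon (D.RightVal v t))
  have hf : ∀ {v t g}, D.RightVal v t g → f v t = F g := fun {v t g} h => by
    exact congrArg F ((Classical.epsilon_spec (p := D.RightVal v t) ⟨g, h⟩).unique h)
  let J : D.Crossing ⊕ D.Crossing → A := Sum.elim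
    (fun τ => τ.sign • (F τ.regionElt - F (τ.regionElt * D.arcElt τ.sourceArc)))
    (fun τ => τ.sign • (F (τ.regionElt * D.arcElt τ.overArc) - F τ.regionElt))
  have hvert : ∀ v, ∃ m, (∀ᶠ s in 𝓝[<] 1, f v s = m) ∧ ∀ᶠ s in 𝓝[>] 0, f (D.next v) s = m := by
    intro v
    obtain ⟨a, L, hL⟩ := D.exists_isSideModel_vertex v
    obtain ⟨g, hg⟩ := hL.exists_rightVal
    refine ⟨F g, ?_, ?_⟩
    · filter_upwards [nhdsWithin_le_nhds ((D.continuous_planePoint v).continuousAt.eventually hg),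
        nhdsWithin_le_nhds eventually_regular, Ioo_mem_nhdsLT one_pos] with s h1 h2 h3
      exact hf (h1 v s (h2 h3.2.ne h3) rfl)
    · rw [D.planePoint_one, ← D.planePoint_zero] at hg
      filter_upwards [nhdsWithin_le_nhds
        ((D.continuous_planePoint (D.next v)).continuousAt.eventually hg),
        nhdsWithin_le_nhds eventually_regular, Ioo_mem_nhdsGT one_pos] with s h1 h2 h3
      exact hf (h1 _ s (h2 h3.1.ne' h3) rfl)
  choose m hm1 hm2 using hvert
  -- By `hvert`, `m v` is the value at the end of `v` and at the start of the next edge, so only the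
  -- crossings on that edge contribute.
  have hedge : ∀ v, m (D.next v) = m v + ∑ x with (strandParam x).1 = D.next v, J x := by
    intro v
    refine sum_jumps (h := f (D.next v)) (time := fun x => ((strandParam x).2 : ℝ))
      (fun x _ => strandParam_mem_Ioo x) ?_ (hm2 v) (hm1 _) ?_ ?_
    · intro x hx y hy e
      refine strandParam_injective (Prod.ext ?_ (Subtype.ext e))
      rw [(Finset.mem_filter.1 hx).2, (Finset.mem_filter.1 hy).2]
    · intro t ht h
      have hr := regular_of_forall_strandParam ht fun x hx =>
        h x (Finset.mem_filter.2 ⟨Finset.mem_univ _, hx⟩)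
      obtain ⟨a, L, hL⟩ := D.exists_isSideModel_regular hr
      obtain ⟨g, hg⟩ := hL.exists_rightVal
      refine ⟨F g, ?_⟩
      filter_upwards [(D.continuous_planePoint _).continuousAt.eventually hg, eventually_regular,
        Ioo_mem_nhds ht.1 ht.2] with s h1 h2 h3
      refine hf (h1 _ s ?_ rfl)
      by_cases e : s = t
      · rwa [e]
      · exact h2 e h3
    · intro x hx
      have hxv := (Finset.mem_filter.1 hx).2
      have hI := strandParam_mem_Ioo x
      rcases x with τ | τ
      · have hv : D.next v = τ.upper.1 := hxv.symm
        have hcr := τ.eventually_rightVal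
        rw [τ.center_eq_upper] at hcr
        -- The factor `-1` stands for the sign of `s - τ.upper.2` just before the crossing.
        refine ⟨F (if 0 < (τ.sign : ℝ) * (-1) then τ.regionElt
          else τ.regionElt * D.arcElt τ.sourceArc), ?_⟩
        rw [hv]
        filter_upwards [(D.continuous_planePoint _).continuousAt.eventually hcr,
          eventually_regular, Ioo_mem_nhds hI.1 hI.2] with s h1 h2 h3
        refine ⟨fun hlt => ?_, fun hlt => ?_⟩
        · have hlt' : s - (τ.upper.2 : ℝ) < 0 := sub_neg.2 hlt
          rw [hf ((h1 _ s (h2 hlt.ne h3) rfl).1 rfl)]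
          rcases τ.cross_ne_zero.lt_or_gt with h | h
          · rw [τ.sign_of_neg h, if_pos, if_pos] <;> push_cast <;> linarith
          · rw [τ.sign_of_pos h, if_neg, if_neg] <;> push_cast <;> linarith
        · have hlt' : 0 < s - (τ.upper.2 : ℝ) := sub_pos.2 hlt
          rw [hf ((h1 _ s (h2 hlt.ne' h3) rfl).1 rfl)]
          simp only [J, Sum.elim_inl]
          rcases τ.cross_ne_zero.lt_or_gt with h | h
          · rw [τ.sign_of_neg h, if_neg, if_pos, neg_one_smul]
            · abel
            all_goals push_cast; linarith
          · rw [τ.sign_of_pos h, if_pos, if_neg, one_smul]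
            · abel
            all_goals push_cast; linarith
      · have hv : D.next v = τ.lower.1 := hxv.symm
        have hcr := τ.eventually_rightVal
        rw [τ.center_eq_lower] at hcr
        refine ⟨F (if 0 < (τ.sign : ℝ) * (-1) then τ.regionElt * D.arcElt τ.overArc
          else τ.regionElt), ?_⟩
        rw [hv]
        filter_upwards [(D.continuous_planePoint _).continuousAt.eventually hcr,
          eventually_regular, Ioo_mem_nhds hI.1 hI.2] with s h1 h2 h3
        refine ⟨fun hlt => ?_, fun hlt => ?_⟩
        · have hlt' : s - (τ.lower.2 : ℝ) < 0 := sub_neg.2 hlt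
          rw [hf ((h1 _ s (h2 hlt.ne h3) rfl).2 rfl)]
          rcases τ.cross_ne_zero.lt_or_gt with h | h
          · rw [τ.sign_of_neg h, if_pos, if_pos] <;> push_cast <;> linarith
          · rw [τ.sign_of_pos h, if_neg, if_neg] <;> push_cast <;> linarith
        · have hlt' : 0 < s - (τ.lower.2 : ℝ) := sub_pos.2 hlt
          rw [hf ((h1 _ s (h2 hlt.ne' h3) rfl).2 rfl)]
          simp only [J, Sum.elim_inr]
          rcases τ.cross_ne_zero.lt_or_gt with h | h
          · rw [τ.sign_of_neg h, if_neg, if_pos, neg_one_smul]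
            · abel
            all_goals push_cast; linarith
          · rw [τ.sign_of_pos h, if_pos, if_neg, one_smul]
            · abel
            all_goals push_cast; linarith
  have hsum : ∑ x, J x = 0 := by
    -- The components are closed: `next` is a permutation, so the values `m` cancel in the sum of
    -- `hedge` over all edges.
    have h1 : ∑ v, m (D.next v) = ∑ v, m v := Equiv.sum_comp D.next m
    have h2 := Equiv.sum_comp D.next fun v => ∑ x with (strandParam x).1 = v, J x
    rw [Finset.sum_congr rfl fun v _ => hedge v, Finset.sum_add_distrib, h2, add_eq_left,
      Finset.sum_fiberwise] at h1
    exact h1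
  rw [Fintype.sum_sum_type, ← Finset.sum_add_distrib] at hsum
  rw [← hsum]
  refine Finset.sum_congr rfl fun τ _ => ?_
  simp only [J, Sum.elim_inl, Sum.elim_inr, ← smul_add]
  congr 1
  abel

end LinkDiagram

-- The abelian extension and the potential of a 2-cocycle.

universe u v w

theorem d0_gen {X : Type u} {Y : Type v} (y : Y) (a b c : X) : d0 X Y 2 (gen y ![a, b, c]) =
    -gen y ![b, c] + gen y ![a, c] - gen y ![a, b] := by
  have h : d0 X Y 2 (gen y ![a, b, c]) =
      QuotientAddGroup.mk (rackD0 X Y 2 (FreeAbelianGroup.of (y, ![a, b, c]))) := rfl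
  have e0 : face0 0 (y, ![a, b, c]) = (y, ![b, c]) :=
    Prod.ext rfl (by funext j; fin_cases j <;> rfl)
  have e1 : face0 1 (y, ![a, b, c]) = (y, ![a, c]) :=
    Prod.ext rfl (by funext j; fin_cases j <;> rfl)
  have e2 : face0 2 (y, ![a, b, c]) = (y, ![a, b]) :=
    Prod.ext rfl (by funext j; fin_cases j <;> rfl)
  rw [h, rackD0, FreeAbelianGroup.lift_apply_of, Fin.sum_univ_three, e0, e1, e2]
  simp [gen, sub_eq_add_neg]

theorem As.lift_of {X : Type u} [Quandle X] {G : Type w} [Group G] (f : X → G)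
    (hf : ∀ x y, f (qop x y) = (f y)⁻¹ * f x * f y) (x : X) : As.lift f hf (As.of x) = f x := by
  exact (FreeGroup.lift_apply_of : FreeGroup.lift f (FreeGroup.of x) = f x)

section Extension

variable {X : Type u} [Quandle X] {A : Type w} [AddCommGroup A]

/-- A 2-cochain as a function of two variables. -/
def cochainFun (φ : Cochain X Unit A 2) (x y : X) : A := φ (gen () ![x, y])

theorem d1_gen {Y : Type v} [XSet X Y] (y : Y) (a b c : X) : d1 X Y 2 (gen y ![a, b, c]) =
    -gen (MulOpposite.op (As.of a) • y) ![b, c] +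
      gen (MulOpposite.op (As.of b) • y) ![qop a b, c] -
      gen (MulOpposite.op (As.of c) • y) ![qop a c, qop b c] := by
  have h : d1 X Y 2 (gen y ![a, b, c]) =
      QuotientAddGroup.mk (rackD1 X Y 2 (FreeAbelianGroup.of (y, ![a, b, c]))) := rfl
  have e0 : face1 0 (y, ![a, b, c]) = (MulOpposite.op (As.of a) • y, ![b, c]) :=
    Prod.ext rfl (by funext j; fin_cases j <;> rfl)
  have e1 : face1 1 (y, ![a, b, c]) = (MulOpposite.op (As.of b) • y, ![qop a b, c]) :=
    Prod.ext rfl (by funext j; fin_cases j <;> rfl)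
  have e2 : face1 2 (y, ![a, b, c]) = (MulOpposite.op (As.of c) • y, ![qop a c, qop b c]) :=
    Prod.ext rfl (by funext j; fin_cases j <;> rfl)
  rw [h, rackD1, FreeAbelianGroup.lift_apply_of, Fin.sum_univ_three, e0, e1, e2]
  simp [gen, sub_eq_add_neg]

/-- Acting on `z` by `y` and then by `x * y`, or by `x` and then by `y`, accumulates the same value.
The terms `φ(x,y)` of the two boundary parts cancel, as the action on one point is trivial. -/
theorem cocycle_identity {φ : Cochain X Unit A 2} (hφ : φ ∈ cocycles X Unit A 2) (z x y : X) :
    cochainFun φ z y + cochainFun φ (qop z y) (qop x y) =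
      cochainFun φ z x + cochainFun φ (qop z x) y := by
  have h : φ (boundary X Unit 2 (gen () ![z, x, y])) = 0 :=
    DFunLike.congr_fun (show φ.comp (boundary X Unit 2) = 0 from hφ) (gen () ![z, x, y])
  rw [boundary, AddMonoidHom.sub_apply, d0_gen, d1_gen] at h
  simp only [map_sub, map_add, map_neg] at h
  simp only [cochainFun]
  rw [← sub_eq_zero, ← h]
  abel

/-- The right multiplication by `b` in the abelian extension of the quandle, restricted to elements
of the quandle. -/
def extPerm (φ : Cochain X Unit A 2) (b : X) : Equiv.Perm (A × X) where
  toFun p := (p.1 + cochainFun φ p.2 b, b ◃ p.2)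
  invFun p := (p.1 - cochainFun φ (b ◃⁻¹ p.2) b, b ◃⁻¹ p.2)
  left_inv p := by simp
  right_inv p := by simp

/-- The action of the associated group on the abelian extension given by a 2-cocycle. -/
def extHom (φ : Cochain X Unit A 2) (hφ : φ ∈ cocycles X Unit A 2) :
    As X →* (Equiv.Perm (A × X))ᵐᵒᵖ :=
  As.lift (fun b => MulOpposite.op (extPerm φ b)) (fun x y => by
    -- The relation is used in the inverse-free form `y (x * y) = x y`, which is the cocycle
    -- identity in the first coordinate and self-distributivity in the second.
    rw [mul_assoc, eq_inv_mul_iff_mul_eq]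
    apply MulOpposite.unop_injective
    ext1 ⟨s, z⟩
    simp only [MulOpposite.unop_mul, MulOpposite.unop_op, Equiv.Perm.mul_apply]
    refine Prod.ext ?_ ?_
    · change s + cochainFun φ z y + cochainFun φ (qop z y) (qop x y) =
        s + cochainFun φ z x + cochainFun φ (qop z x) y
      rw [add_assoc, add_assoc, cocycle_identity hφ]
    · change (y ◃ x) ◃ (y ◃ z) = y ◃ (x ◃ z)
      exact Shelf.self_distrib.symm)

theorem extHom_of {φ : Cochain X Unit A 2} (hφ : φ ∈ cocycles X Unit A 2) (b : X) :
    extHom φ hφ (As.of b) = MulOpposite.op (extPerm φ b) :=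
  As.lift_of _ _ _

theorem toPermOp_of (b : X) : As.toPermOp X (As.of b) = MulOpposite.op (Rack.act' b) :=
  As.lift_of _ _ _

/-- The projection `A × X → X` is equivariant: this holds on generators and passes to products and
inverses. -/
theorem extHom_snd {φ : Cochain X Unit A 2} (hφ : φ ∈ cocycles X Unit A 2) (g : As X)
    (p : A × X) : ((extHom φ hφ g).unop p).2 = orbitMap X p.2 g := by
  change _ = (As.toPermOp X g).unop p.2
  have hg : g ∈ Subgroup.closure (Set.range (As.of : X → As X)) := by
    have : Subgroup.closure (Set.range (As.of : X → As X)) = ⊤ :=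
      PresentedGroup.closure_range_of (asRels X)
    rw [this]
    exact Subgroup.mem_top g
  induction hg using Subgroup.closure_induction generalizing p with
  | mem x hx =>
    obtain ⟨b, rfl⟩ := hx
    rw [extHom_of, toPermOp_of]
    rfl
  | one => simp
  | mul x y _ _ hx hy =>
    simp only [map_mul, MulOpposite.unop_mul, Equiv.Perm.mul_apply]
    rw [hy, hx]
  | inv x _ hx =>
    simp only [map_inv, MulOpposite.unop_inv]
    rw [Equiv.Perm.eq_inv_iff_eq, ← hx, Equiv.Perm.inv_def, Equiv.apply_symm_apply]

/-- The potential whose difference along a generator is the value of the cocycle. -/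
def potential (φ : Cochain X Unit A 2) (hφ : φ ∈ cocycles X Unit A 2) (x : X) (g : As X) : A :=
  ((extHom φ hφ g).unop (0, x)).1

theorem potential_mul_of {φ : Cochain X Unit A 2} (hφ : φ ∈ cocycles X Unit A 2) (x : X)
    (g : As X) (b : X) : potential φ hφ x (g * As.of b) =
      potential φ hφ x g + cochainFun φ (orbitMap X x g) b := by
  rw [potential, map_mul, extHom_of, MulOpposite.unop_mul, Equiv.Perm.mul_apply, potential,
    ← extHom_snd hφ g (0, x)]
  rfl

end Extension

theorem inducedMap_gen {Q : Type u} {Y Z : Type*} {X : Type v} (p : Y → Z) (f : Q → X) (y : Y)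
    (a b : Q) : inducedMap p f 2 (gen y ![a, b]) = gen (p y) ![f a, f b] := by
  have : f ∘ ![a, b] = ![f a, f b] := by funext j; fin_cases j <;> rfl
  rw [← this]
  exact congrArg QuotientAddGroup.mk (FreeAbelianGroup.map_of_apply _)

/-- The sign of `iota` is `(-1)^2` and that of `shift` is `(-1)^3`. The first term is the quandle
cocycle weight; the other two form a difference of potentials. -/
theorem shiftPullback_iotaPullback_gen {X : Type u} {A : Type w} [AddCommGroup A]
    (φ : Cochain X Unit A 2) (z a b : X) :
    iotaPullback (shiftPullback φ) (gen z ![a, b]) =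
      cochainFun φ a b - cochainFun φ z b + cochainFun φ z a := by
  have h : iota X 2 (gen z ![a, b]) = gen () ![z, a, b] := by
    have : (Fin.cons z ![a, b] : Fin 3 → X) = ![z, a, b] := rfl
    rw [iota, even_two.neg_one_pow, one_smul, ← this]
    exact congrArg QuotientAddGroup.mk (FreeAbelianGroup.map_of_apply _)
  rw [iotaPullback, shiftPullback, AddMonoidHom.comp_apply, AddMonoidHom.comp_apply, h, shift,
    AddMonoidHom.smul_apply, d0_gen, (show (-1 : ℤ) ^ (2 + 1) = -1 by norm_num), neg_one_smul]
  simp only [map_sub, map_add, map_neg, cochainFun]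
  abel

end ShiftQuandle

end

/-! ### Comparison of the two invariants. -/

theorem theorem1p1 {X : Type*} [Quandle X] [Finite X] {A : Type*} [AddCommGroup A]
    (φ : Cochain X Unit A 2) (hφ : φ ∈ cocycles X Unit A 2) (x : X)
    (L : OrientedLink) (D : LinkDiagram) (hD : D.IsDiagramOf L) :
    D.shadowCocycleInvariant (shiftPullback φ) x = D.quandleCocycleInvariant φ := by
  refine Finset.sum_congr rfl fun c _ => ?_
  refine congrArg (fun a : A => AddMonoidAlgebra.single a (1 : ℤ)) ?_
  -- The function of the regions is the potential pulled back along the colouring; its differences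
  -- at a crossing are the two terms in which the weights differ.
  have key := LinkDiagram.sum_sign_smul_eq_zero (D := D)
    fun g => potential φ hφ x (As.map c g)
  have hmap : ∀ (g : As D.FundamentalQuandle) (a : D.Arc), potential φ hφ x
      (As.map c (g * D.arcElt a)) = potential φ hφ x (As.map c g) +
        cochainFun φ (orbitMap X x (As.map c g)) (c (D.arcGen a)) := by
    intro g a
    have : As.map c (D.arcElt a) = As.of (c (D.arcGen a)) := As.lift_of _ _ _
    rw [map_mul, this, potential_mul_of]
  simp only [hmap, add_sub_add_left_eq_sub] at key
  rw [LinkDiagram.fundamentalCycle]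
  simp only [map_sum, LinkDiagram.weight, map_zsmul, inducedMap_gen, id]
  -- The shadow weight minus the quandle weight is `-ε (φ(z,b) - φ(z,a))`, hence the extra negation
  -- before the termwise comparison with `key`.
  rw [← sub_eq_zero, ← Finset.sum_sub_distrib, ← neg_eq_zero, ← Finset.sum_neg_distrib, ← key]
  refine Finset.sum_congr rfl fun τ _ => ?_
  rw [shiftPullback_iotaPullback_gen, ← smul_sub, ← smul_neg]
  congr 1
  change -(_ - cochainFun φ _ _) = _
  simp only [LinkDiagram.Crossing.regionElt]
  abel
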